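/- Let $G$ be a Lie group with Lie algebra $\mathfrak g$, and let $p\colon P\to M$ be a $G$-equivariant principal $U(1)$-bundle, i.e. a smooth principal $U(1)$-bundle together with left actions $\phi\mapsto\phi_P$, $\phi\mapsto\phi_M$ of $G$ on $P$ and $M$ such that $p$ is $G$-equivariant and the action on $P$ commutes with that of $U(1)$. Assume that $q_G\colon M\to M/G$ and $\bar q_G\colon P\to P/G$ are (left) principal $G$-bundles. For $X\in\mathfrak g$ write $X_P(y)=\frac{d}{dt}|_{t=0}\exp(-tX)_P(y)$, and similarly $X_M$. Let $\Xi\in\Omega^1(P,i\mathbb R)$ be a $G$-invariant connection on $P\to M$ and let $\Theta\in\Omega^1(M,\mathfrak g)$ be a connection on $M\to M/G$ (so $\Theta(X_M)=X$ and $\phi_M^*\Theta=\mathrm{Ad}_\phi\circ\Theta$). Put $\Xi(\Theta)(v)=\Xi\big((\Theta(p_*v))_P\big)$ for $v\in TP$, and let $\underline\Xi_\Theta$ be the projection of $\Xi-\Xi(\Theta)$ to $P/G$, i.e. the $1$-form with $\bar q_G^*\underline\Xi_\Theta=\Xi-\Xi(\Theta)$. Curves are piecewise $C^1$ maps defined on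 $[0,1]$. For $\phi\in G$ let $\mathcal C^\phi(M)$ be the set of curves $\sigma$ in $M$ with $\sigma(1)=\phi_M(\sigma(0))$; for $\sigma\in\mathcal C^\phi(M)$ the equivariant holonomy $\mathrm{Hol}^\Xi_\phi(\sigma)\in U(1)$ is characterized by $\bar\sigma^y(1)=\phi_P(y)\cdot\mathrm{Hol}^\Xi_\phi(\sigma)$ for every $y\in p^{-1}(\sigma(0))$, where $\bar\sigma^y$ is the $\Xi$-horizontal lift of $\sigma$ starting at $y$. For a loop $\gamma$ in $M/G$ and $x\in q_G^{-1}(\gamma(0))$ at which a $\Theta$-horizontal lift of $\gamma$ starts, $\mathrm{Hol}^{\Theta,x}(\gamma)\in G$ is the element that takes $x$ to the end point of that lift. The holonomy $\mathrm{Hol}^{\underline\Xi_\Theta}(\gamma)\in U(1)$ is characterized by $c(1)=c(0)\cdot\mathrm{Hol}^{\underline\Xi_\Theta}(\gamma)$ for all $\underline\Xi_\Theta$-horizontal lifts $c$ of $\gamma$ to $P/G$. Then $P/G\to M/G$ is a principal $U(1)$-bundle and $\underline\Xi_\Theta$ exists and is a connection on it. If $\gamma$ is a loop on $M/G$ and $\hat\gamma$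 is a $\Theta$-horizontal lift of $\gamma$, then, with $\phi=\mathrm{Hol}^{\Theta,\hat\gamma(0)}(\gamma)$, the holonomies $\phi$, $\mathrm{Hol}^{\underline\Xi_\Theta}(\gamma)$ and $\mathrm{Hol}^\Xi_\phi(\hat\gamma)$ are well defined, and $$\hat\gamma\in\mathcal C^{\phi}(M)\qquad\text{and}\qquad \mathrm{Hol}^{\underline\Xi_\Theta}(\gamma)=\mathrm{Hol}^{\Xi}_{\phi}(\hat\gamma).$$ -/

import Mathlib

open Set
open scoped Manifold ContDiff

noncomputable section

namespace EquivHol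

/-! Manifolds are smooth and without boundary, modelled on normed spaces; curves are functions on
`ℝ` of which only the restriction to `I = [0, 1]` is ever used. -/

section Curves

variable {E : Type*} [NormedAddCommGroup E] [NormedSpace ℝ E]
  {M : Type*} [TopologicalSpace M] [ChartedSpace E M]

/-- A curve `I → M` is piecewise `C¹`: it is continuous, and there is a finite set `S` of break
points such that it is `C¹` (one-sidedly at the end points) on every closed subinterval of `I`
without break points in its interior. -/
def IsPiecewiseC1 (γ : ℝ → M) : Prop :=
  ContinuousOn γ (Icc 0 1) ∧ ∃ S : Finset ℝ, ∀ a b : ℝ, 0 ≤ a → a < b → b ≤ 1 →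
    (∀ s ∈ S, s ∉ Ioo a b) → ContMDiffOn 𝓘(ℝ, ℝ) 𝓘(ℝ, E) 1 γ (Icc a b)

/-- The loop space `C(M)`. -/
def loops (E : Type*) [NormedAddCommGroup E] [NormedSpace ℝ E]
    (M : Type*) [TopologicalSpace M] [ChartedSpace E M] : Set (ℝ → M) :=
  {γ | IsPiecewiseC1 (E := E) γ ∧ γ 1 = γ 0}

/-- The space `C^φ(M)` of piecewise `C¹` curves with `γ(1) = φ_M(γ(0))`. -/
def twistedLoops (E : Type*) [NormedAddCommGroup E] [NormedSpace ℝ E]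
    (M : Type*) [TopologicalSpace M] [ChartedSpace E M] {G : Type*} [Group G] [MulAction G M]
    (φ : G) : Set (ℝ → M) :=
  {γ | IsPiecewiseC1 (E := E) γ ∧ γ 1 = φ • γ 0}

/-- The velocity of a curve at a time where it is differentiable. -/
def velocity (E : Type*) [NormedAddCommGroup E] [NormedSpace ℝ E]
    {M : Type*} [TopologicalSpace M] [ChartedSpace E M] (γ : ℝ → M) (t : ℝ) :
    TangentSpace 𝓘(ℝ, E) (γ t) :=
  mfderiv 𝓘(ℝ, ℝ) 𝓘(ℝ, E) γ t (1 : ℝ)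

end Curves

/-- `V`-valued differential 1-forms on `M` (not necessarily smooth). -/
abbrev OneForm (E : Type*) [NormedAddCommGroup E] [NormedSpace ℝ E]
    (M : Type*) [TopologicalSpace M] [ChartedSpace E M]
    (V : Type*) [NormedAddCommGroup V] [NormedSpace ℝ V] :=
  ∀ x : M, TangentSpace 𝓘(ℝ, E) x →L[ℝ] V

section Forms

variable {E : Type*} [NormedAddCommGroup E] [NormedSpace ℝ E]
  {M : Type*} [TopologicalSpace M] [ChartedSpace E M]
  {E' : Type*} [NormedAddCommGroup E'] [NormedSpace ℝ E']
  {N : Type*} [TopologicalSpace N] [ChartedSpace E' N]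
  {V : Type*} [NormedAddCommGroup V] [NormedSpace ℝ V]

/-- A 1-form is smooth when it is smooth as a (fibrewise linear) function on the tangent bundle. -/
def IsSmoothForm [IsManifold 𝓘(ℝ, E) ∞ M] (α : OneForm E M V) : Prop :=
  ContMDiff 𝓘(ℝ, E).tangent 𝓘(ℝ, V) ∞
    (fun v : TangentBundle 𝓘(ℝ, E) M => α v.proj v.snd)

/-- The pull-back `f^* α` of a 1-form. -/
def pullbackForm (f : M → N) (α : OneForm E' N V) : OneForm E M V :=
  fun x => (α (f x)).comp (mfderiv 𝓘(ℝ, E) 𝓘(ℝ, E') f x)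

open Classical in
/-- The projection of a 1-form `α` on `M` along `f : M → N`: the 1-form `η` on `N` with
`f^* η = α` if `α` is projectable (it is unique if `f` is a surjective submersion), and `0`
otherwise. -/
def projectForm (f : M → N) (α : OneForm E M V) : OneForm E' N V :=
  if h : ∃ η : OneForm E' N V, pullbackForm f η = α then h.choose else 0

end Forms

section Principal

variable {EK : Type*} [NormedAddCommGroup EK] [NormedSpace ℝ EK]
  (K : Type*) [TopologicalSpace K] [ChartedSpace EK K] [Group K]
  {EP : Type*} [NormedAddCommGroup EP] [NormedSpace ℝ EP]
  {P : Type*} [TopologicalSpace P] [ChartedSpace EP P] [MulAction K P]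
  {EB : Type*} [NormedAddCommGroup EB] [NormedSpace ℝ EB]
  {B : Type*} [TopologicalSpace B] [ChartedSpace EB B]

/-- `p : P → B` is a smooth principal bundle for the left action of the Lie group `K`: the action
is smooth and preserves the fibres, `p` is smooth, and over a neighbourhood of every point of `B`
there is a `K`-equivariant diffeomorphism `p⁻¹(U) ≃ U × K` over `U`. (For an abelian group such as
`U(1)` left actions and right actions are the same.) -/
structure IsPrincipalBundle (p : P → B) : Prop where
  contMDiff_smul : ContMDiff (𝓘(ℝ, EK).prod 𝓘(ℝ, EP)) 𝓘(ℝ, EP) ∞ (fun z : K × P => z.1 • z.2)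
  contMDiff_proj : ContMDiff 𝓘(ℝ, EP) 𝓘(ℝ, EB) ∞ p
  proj_smul : ∀ (k : K) (y : P), p (k • y) = p y
  locally_trivial : ∀ b : B, ∃ U : Set B, IsOpen U ∧ b ∈ U ∧
    ∃ e : OpenPartialHomeomorph P (B × K),
      e.source = p ⁻¹' U ∧ e.target = U ×ˢ univ ∧
      ContMDiffOn 𝓘(ℝ, EP) (𝓘(ℝ, EB).prod 𝓘(ℝ, EK)) ∞ e e.source ∧
      ContMDiffOn (𝓘(ℝ, EB).prod 𝓘(ℝ, EK)) 𝓘(ℝ, EP) ∞ e.symm e.target ∧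
      ∀ y ∈ e.source, (e y).1 = p y ∧ ∀ k : K, (e (k • y)).2 = k * (e y).2

end Principal

section Connections

variable {EG : Type*} [NormedAddCommGroup EG] [NormedSpace ℝ EG]
  {G : Type*} [TopologicalSpace G] [ChartedSpace EG G] [Group G]
  {EP : Type*} [NormedAddCommGroup EP] [NormedSpace ℝ EP]
  {P : Type*} [TopologicalSpace P] [ChartedSpace EP P]

/-! The Lie algebra `𝔤 = T₁G` is, as a vector space, the model space `EG` of `G`. -/

/-- The value `X_P(y) = d/dt|₀ exp(-tX)_P(y)` at `y` of the fundamental vector field of `X ∈ 𝔤`,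
that is, minus the derivative at `1` of the orbit map `g ↦ g • y` applied to `X`
(note `1 • y = y`). -/
def fundamentalVector (EG : Type*) [NormedAddCommGroup EG] [NormedSpace ℝ EG]
    (G : Type*) [TopologicalSpace G] [ChartedSpace EG G] [Group G] [MulAction G P] (y : P) :
    EG →L[ℝ] TangentSpace 𝓘(ℝ, EP) y :=
  -(mfderiv 𝓘(ℝ, EG) 𝓘(ℝ, EP) (fun g : G => g • y) (1 : G) : EG →L[ℝ] EP)

/-- The adjoint representation `Ad_g : 𝔤 → 𝔤`, the derivative at `1` of `h ↦ g h g⁻¹`. -/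
def Ad (EG : Type*) [NormedAddCommGroup EG] [NormedSpace ℝ EG]
    {G : Type*} [TopologicalSpace G] [ChartedSpace EG G] [Group G] (g : G) : EG →L[ℝ] EG :=
  mfderiv 𝓘(ℝ, EG) 𝓘(ℝ, EG) (fun h : G => g * h * g⁻¹) (1 : G)

/-- `Θ ∈ Ω¹(P, 𝔤)` is a connection form for the left action of `G` on `P`: it is smooth,
`Θ(X_P) = X` for `X ∈ 𝔤` and `φ_P^* Θ = Ad_φ ∘ Θ` for `φ ∈ G`. -/
structure IsConnection (G : Type*) [TopologicalSpace G] [ChartedSpace EG G] [Group G]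
    [MulAction G P] [IsManifold 𝓘(ℝ, EP) ∞ P] (Θ : OneForm EP P EG) : Prop where
  smooth : IsSmoothForm Θ
  vertical : ∀ (y : P) (X : EG), Θ y (fundamentalVector EG G y X) = X
  equivariant : ∀ (g : G) (y : P) (v : TangentSpace 𝓘(ℝ, EP) y),
    pullbackForm (fun z : P => g • z) Θ y v = Ad EG g (Θ y v)

/-- The vector field `ξ_P` generating the action of `U(1)`: `ξ_P(y) = d/dt|₀ y · e^{it}`. -/
def circleVector [MulAction Circle P] (y : P) : TangentSpace 𝓘(ℝ, EP) y :=
  (velocity EP (fun t : ℝ => Circle.exp t • y) 0 : EP)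

/-- `Ξ ∈ Ω¹(P, iℝ)` is a connection form for the action of `U(1)` on `P`: it is smooth, takes
values in `iℝ ⊆ ℂ`, satisfies `Ξ(ξ_P) = i`, and is `U(1)`-invariant. -/
structure IsCircleConnection [MulAction Circle P] [IsManifold 𝓘(ℝ, EP) ∞ P]
    (Ξ : OneForm EP P ℂ) : Prop where
  smooth : IsSmoothForm Ξ
  imaginary : ∀ (y : P) (v : TangentSpace 𝓘(ℝ, EP) y), (Ξ y v).re = 0
  vertical : ∀ y : P, Ξ y (circleVector y) = Complex.I
  invariant : ∀ u : Circle, pullbackForm (fun z : P => u • z) Ξ = Ξ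

/-- A 1-form is `G`-invariant: `φ_P^* α = α` for all `φ ∈ G`. -/
def IsInvariantForm (G : Type*) [Group G] [MulAction G P]
    {V : Type*} [NormedAddCommGroup V] [NormedSpace ℝ V] (α : OneForm EP P V) : Prop :=
  ∀ g : G, pullbackForm (fun z : P => g • z) α = α

end Connections

section Holonomy

variable {EP : Type*} [NormedAddCommGroup EP] [NormedSpace ℝ EP]
  {P : Type*} [TopologicalSpace P] [ChartedSpace EP P]
  {B : Type*}
  {V : Type*} [NormedAddCommGroup V] [NormedSpace ℝ V]

/-- `c` is an `α`-horizontal lift of the curve `γ : I → B` along `p : P → B`: a piecewise `C¹` curve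
over `γ` whose velocity vectors are annihilated by `α`. -/
structure IsHorizontalLift (p : P → B) (α : OneForm EP P V) (γ : ℝ → B) (c : ℝ → P) : Prop where
  piecewise : IsPiecewiseC1 (E := EP) c
  proj_eq : ∀ t ∈ Icc (0 : ℝ) 1, p (c t) = γ t
  horizontal : ∀ t ∈ Ioo (0 : ℝ) 1, MDifferentiableAt 𝓘(ℝ, ℝ) 𝓘(ℝ, EP) c t →
    α (c t) (velocity EP c t) = 0

/-- `k` is the holonomy of the loop `γ` at the point `y` over `γ(0)`: there is a horizontal lift
starting at `y`, and every such lift `c` satisfies `c(1) = k • c(0)`. -/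
def IsHolonomyAt {K : Type*} [Group K] [MulAction K P]
    (p : P → B) (α : OneForm EP P V) (y : P) (γ : ℝ → B) (k : K) : Prop :=
  (∃ c, IsHorizontalLift p α γ c ∧ c 0 = y) ∧
    ∀ c, IsHorizontalLift p α γ c → c 0 = y → c 1 = k • y

open Classical in
/-- The holonomy `Hol^{α, y}(γ) ∈ K`. -/
def holonomyAt (K : Type*) [Group K] [MulAction K P]
    (p : P → B) (α : OneForm EP P V) (y : P) (γ : ℝ → B) : K :=
  if h : ∃ k : K, IsHolonomyAt p α y γ k then h.choose else 1

/-- `u` is the holonomy of the loop `γ` for a form on a `U(1)`-bundle: it is the holonomy at every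
point of the fibre over `γ(0)`. -/
def IsHolonomy [MulAction Circle P]
    (p : P → B) (Ξ : OneForm EP P ℂ) (γ : ℝ → B) (u : Circle) : Prop :=
  ∀ y : P, p y = γ 0 → IsHolonomyAt p Ξ y γ u

open Classical in
/-- The holonomy `Hol^Ξ(γ) ∈ U(1)` of a loop. -/
def holonomy [MulAction Circle P] (p : P → B) (Ξ : OneForm EP P ℂ) (γ : ℝ → B) : Circle :=
  if h : ∃ u : Circle, IsHolonomy p Ξ γ u then h.choose else 1

/-- `u` is the `φ`-equivariant holonomy of `γ ∈ C^φ(M)`: for every `y` over `γ(0)` there is a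
horizontal lift of `γ` starting at `y`, and every such lift ends at `φ_P(y) · u`. -/
def IsEquivariantHolonomy [MulAction Circle P] {G : Type*} [Group G] [MulAction G P]
    (p : P → B) (Ξ : OneForm EP P ℂ) (φ : G) (γ : ℝ → B) (u : Circle) : Prop :=
  ∀ y : P, p y = γ 0 → (∃ c, IsHorizontalLift p Ξ γ c ∧ c 0 = y) ∧
    ∀ c, IsHorizontalLift p Ξ γ c → c 0 = y → c 1 = u • φ • y

open Classical in
/-- The `φ`-equivariant holonomy `Hol_φ^Ξ(γ) ∈ U(1)`. -/
def equivariantHolonomy [MulAction Circle P] {G : Type*} [Group G] [MulAction G P]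
    (p : P → B) (Ξ : OneForm EP P ℂ) (φ : G) (γ : ℝ → B) : Circle :=
  if h : ∃ u : Circle, IsEquivariantHolonomy p Ξ φ γ u then h.choose else 1

end Holonomy

section Quotients

variable (G : Type*) [Group G]

/-- The orbit space `M/G`, with the quotient topology. -/
abbrev Orbits (M : Type*) [MulAction G M] := Quotient (MulAction.orbitRel G M)

/-- The quotient map `M → M/G`. -/
def quotientMap {M : Type*} [MulAction G M] (x : M) : Orbits G M :=
  Quotient.mk (MulAction.orbitRel G M) x

variable {P : Type*} [MulAction G P]

/-- The map `P/G → M/G` induced by a `G`-equivariant map `p : P → M`. -/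
def quotientProj {M : Type*} [MulAction G M] (p : P → M) (hp : ∀ (g : G) (y : P), p (g • y) = g • p y) :
    Orbits G P → Orbits G M :=
  Quotient.map p (by
    rintro a b ⟨g, rfl⟩
    exact ⟨g, (hp g b).symm⟩)

/-- The action of `U(1)` on `P/G` induced by an action on `P` commuting with that of `G`. -/
instance orbitsCircleAction [MulAction Circle P] [SMulCommClass G Circle P] :
    MulAction Circle (Orbits G P) where
  smul u := Quotient.map (fun y => u • y) (by
    rintro a b ⟨g, rfl⟩
    exact ⟨g, smul_comm g u b⟩)
  one_smul := by
    rintro ⟨y⟩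
    exact congrArg (Quotient.mk _) (one_smul Circle y)
  mul_smul := by
    rintro u v ⟨y⟩
    exact congrArg (Quotient.mk _) (mul_smul u v y)

end Quotients

section QuotientConnection

variable {EG : Type*} [NormedAddCommGroup EG] [NormedSpace ℝ EG]
  (G : Type*) [TopologicalSpace G] [ChartedSpace EG G] [Group G]
  {EM : Type*} [NormedAddCommGroup EM] [NormedSpace ℝ EM]
  {M : Type*} [TopologicalSpace M] [ChartedSpace EM M] [MulAction G M]
  {EP : Type*} [NormedAddCommGroup EP] [NormedSpace ℝ EP]
  {P : Type*} [TopologicalSpace P] [ChartedSpace EP P] [MulAction G P]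

/-- The 1-form `Ξ(Θ)` on `P`, `Ξ(Θ)(v) = Ξ((Θ(p_* v))_P)`. -/
def formOfConnections (p : P → M) (Ξ : OneForm EP P ℂ) (Θ : OneForm EM M EG) : OneForm EP P ℂ :=
  fun y => ((Ξ y).comp (fundamentalVector EG G y)).comp (pullbackForm p Θ y)

/-- The quotient connection `Ξ_Θ` on `P/G`: the projection of `Ξ - Ξ(Θ)` along `P → P/G`. -/
def quotientConnection (p : P → M) (Ξ : OneForm EP P ℂ) (Θ : OneForm EM M EG)
    (EPG : Type*) [NormedAddCommGroup EPG] [NormedSpace ℝ EPG] [ChartedSpace EPG (Orbits G P)] :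
    OneForm EPG (Orbits G P) ℂ :=
  projectForm (quotientMap G) (Ξ - formOfConnections G p Ξ Θ)

end QuotientConnection

end EquivHol

end

noncomputable section

namespace EquivHol

/-! ### Chain and product rules for derivatives and pull-backs of 1-forms -/

section
variable {E : Type*} [NormedAddCommGroup E] [NormedSpace ℝ E]
  {M : Type*} [TopologicalSpace M] [ChartedSpace E M]
  {E' : Type*} [NormedAddCommGroup E'] [NormedSpace ℝ E']
  {M' : Type*} [TopologicalSpace M'] [ChartedSpace E' M']
  {F : Type*} [NormedAddCommGroup F] [NormedSpace ℝ F]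
  {N : Type*} [TopologicalSpace N] [ChartedSpace F N]
  {EX : Type*} [NormedAddCommGroup EX] [NormedSpace ℝ EX]
  {X : Type*} [TopologicalSpace X] [ChartedSpace EX X]

/-! Let `c` be a Ξ-horizontal lift of `γhat` starting at `y`. Then Ξ kills the velocity of `c`, and
Ξ(Θ) kills it too, because it depends on that velocity only through Θ of the velocity of `γhat`. So
Ξ - Ξ(Θ) vanishes along `c`, and the projection of `c` to P/G is a horizontal lift of γ for the
quotient connection (`IsHorizontalLift.quotientMap_comp`). If `c` ends at u • φ • y, its projection
ends at u times the orbit of `y`, since φ is invisible in P/G. Hence u is also the holonomy of γ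
(`isHolonomy_quotientConnection`).

The rest of the work is that every object in this argument exists. P/G → M/G is trivialized by
choosing in each orbit the point lying over a local section of M → M/G
(`isPrincipalBundle_quotientProj`). The form Ξ - Ξ(Θ) is basic, and a basic form on a principal
bundle descends (`isBasicForm_sub_formOfConnections`, `IsPrincipalBundle.exists_pullbackForm_eq`).

Holonomies are well defined because two horizontal lifts differ by a constant: the Leibniz rule for
h(t) • c(t) shows that the derivative of h vanishes (`SeparatesFibers.mfderiv_eq_zero`,
`IsHorizontalLift.exists_smul_eq`). This covers G and U(1) at once. Existence of lifts is needed
only for U(1), where it is an integration and not a differential equation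
(`IsCircleConnection.exists_isHorizontalLift`); the Θ-horizontal lift is given. -/

theorem mfderiv_comp_prodMk_apply {f : M × M' → N} {a : X → M} {b : X → M'} {x : X}
    (hf : MDifferentiableAt (𝓘(ℝ, E).prod 𝓘(ℝ, E')) 𝓘(ℝ, F) f (a x, b x))
    (ha : MDifferentiableAt 𝓘(ℝ, EX) 𝓘(ℝ, E) a x)
    (hb : MDifferentiableAt 𝓘(ℝ, EX) 𝓘(ℝ, E') b x) (v : TangentSpace 𝓘(ℝ, EX) x) :
    mfderiv 𝓘(ℝ, EX) 𝓘(ℝ, F) (fun z => f (a z, b z)) x v =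
      mfderiv 𝓘(ℝ, E) 𝓘(ℝ, F) (fun m => f (m, b x)) (a x) (mfderiv 𝓘(ℝ, EX) 𝓘(ℝ, E) a x v) +
      mfderiv 𝓘(ℝ, E') 𝓘(ℝ, F) (fun m => f (a x, m)) (b x)
        (mfderiv 𝓘(ℝ, EX) 𝓘(ℝ, E') b x v) := by
  have h1 := mfderiv_comp_apply (I := 𝓘(ℝ, EX)) (I' := 𝓘(ℝ, E).prod 𝓘(ℝ, E')) (I'' := 𝓘(ℝ, F))
    (f := fun z => (a z, b z)) (g := f) x hf (ha.prodMk hb) v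
  have h2 := mfderiv_prod_eq_add_apply (I := 𝓘(ℝ, E)) (I' := 𝓘(ℝ, E')) (I'' := 𝓘(ℝ, F))
    (v := mfderiv 𝓘(ℝ, EX) (𝓘(ℝ, E).prod 𝓘(ℝ, E')) (fun z => (a z, b z)) x v) hf
  rw [ha.mfderiv_prod hb] at h1 h2
  exact h1.trans h2

/-- A `1`-form as a function on the tangent bundle. -/
def formMap {V : Type*} [NormedAddCommGroup V] [NormedSpace ℝ V] (α : OneForm E M V)
    (v : TangentBundle 𝓘(ℝ, E) M) : V :=
  α v.proj v.snd

theorem pullbackForm_apply {V : Type*} [NormedAddCommGroup V] [NormedSpace ℝ V] (f : X → M)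
    (α : OneForm E M V) (x : X) (v : TangentSpace 𝓘(ℝ, EX) x) :
    pullbackForm f α x v = formMap α (tangentMap 𝓘(ℝ, EX) 𝓘(ℝ, E) f ⟨x, v⟩) :=
  rfl

theorem pullbackForm_comp_apply {V : Type*} [NormedAddCommGroup V] [NormedSpace ℝ V] {g : M → N}
    {f : X → M} {α : OneForm F N V} {x : X}
    (hg : MDifferentiableAt 𝓘(ℝ, E) 𝓘(ℝ, F) g (f x))
    (hf : MDifferentiableAt 𝓘(ℝ, EX) 𝓘(ℝ, E) f x) (v : TangentSpace 𝓘(ℝ, EX) x) :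
    pullbackForm (g ∘ f) α x v = pullbackForm f (pullbackForm (E := E) g α) x v :=
  congrArg (α (g (f x))) (mfderiv_comp_apply x hg hf v)

theorem pullbackForm_congr {V : Type*} [NormedAddCommGroup V] [NormedSpace ℝ V] {f g : X → M}
    {α : OneForm E M V} {x : X} (h : f =ᶠ[nhds x] g) (v : TangentSpace 𝓘(ℝ, EX) x) :
    pullbackForm f α x v = pullbackForm g α x v := by
  simp only [pullbackForm_apply, tangentMap]
  have h1 : f x = g x := h.eq_of_nhds
  have h2 : (mfderiv 𝓘(ℝ, EX) 𝓘(ℝ, E) f x : EX →L[ℝ] E) = mfderiv 𝓘(ℝ, EX) 𝓘(ℝ, E) g x :=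
    h.mfderiv_eq
  -- `f x` and `g x` are equal but their tangent spaces are distinct types; both are the model
  -- space, so the comparison is made in the tangent bundle.
  have h3 : ∀ (y z : M), y = z → ∀ w : E, formMap α (⟨y, w⟩ : TangentBundle 𝓘(ℝ, E) M) =
      formMap α (⟨z, w⟩ : TangentBundle 𝓘(ℝ, E) M) := by
    rintro y z rfl w; rfl
  exact (h3 _ _ h1 _).trans (congrArg (fun L : EX →L[ℝ] E =>
    formMap α (⟨g x, L v⟩ : TangentBundle 𝓘(ℝ, E) M)) h2)

end

/-! ### Smooth actions, fundamental vectors and the Leibniz rule -/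

section Action

variable {EG : Type*} [NormedAddCommGroup EG] [NormedSpace ℝ EG]
  {G : Type*} [TopologicalSpace G] [ChartedSpace EG G] [Group G]
  {EP : Type*} [NormedAddCommGroup EP] [NormedSpace ℝ EP]
  {P : Type*} [TopologicalSpace P] [ChartedSpace EP P] [MulAction G P]
  {EX : Type*} [NormedAddCommGroup EX] [NormedSpace ℝ EX]
  {X : Type*} [TopologicalSpace X] [ChartedSpace EX X]
  {V : Type*} [NormedAddCommGroup V] [NormedSpace ℝ V]

/-- The action of `G` on `P` is smooth. -/
abbrev SmoothAction (EG G EP P : Type*) [NormedAddCommGroup EG] [NormedSpace ℝ EG]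
    [TopologicalSpace G] [ChartedSpace EG G] [Group G] [NormedAddCommGroup EP] [NormedSpace ℝ EP]
    [TopologicalSpace P] [ChartedSpace EP P] [MulAction G P] : Prop :=
  ContMDiff (𝓘(ℝ, EG).prod 𝓘(ℝ, EP)) 𝓘(ℝ, EP) ∞ (fun z : G × P => z.1 • z.2)

theorem SmoothAction.contMDiff_smul_left (h : SmoothAction EG G EP P) (g : G) :
    ContMDiff 𝓘(ℝ, EP) 𝓘(ℝ, EP) ∞ (fun y : P => g • y) :=
  ContMDiff.comp (g := fun z : G × P => z.1 • z.2) (f := fun y => (g, y)) h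
    (contMDiff_const.prodMk contMDiff_id)

theorem SmoothAction.contMDiff_orbit (h : SmoothAction EG G EP P) (y : P) :
    ContMDiff 𝓘(ℝ, EG) 𝓘(ℝ, EP) ∞ (fun g : G => g • y) :=
  ContMDiff.comp (g := fun z : G × P => z.1 • z.2) (f := fun g => (g, y)) h
    (contMDiff_id.prodMk contMDiff_const)

/-- A form is basic when it is invariant and kills the fundamental vector fields. -/
structure IsBasicForm (G : Type*) [TopologicalSpace G] [ChartedSpace EG G] [Group G]
    [MulAction G P] (α : OneForm EP P V) : Prop where
  invariant : IsInvariantForm G α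
  fundamental : ∀ (y : P) (X : EG), α y (fundamentalVector EG G y X) = 0

/-- A form distinguishes vertical directions when its kernel is invariant and contains no nonzero
fundamental vector. -/
structure SeparatesFibers (G : Type*) [TopologicalSpace G] [ChartedSpace EG G] [Group G]
    [MulAction G P] (α : OneForm EP P V) : Prop where
  kernel_invariant : ∀ (g : G) (y : P) (v : TangentSpace 𝓘(ℝ, EP) y), α y v = 0 →
    pullbackForm (fun z : P => g • z) α y v = 0
  fundamental : ∀ (y : P) (X : EG), α y (fundamentalVector EG G y X) = 0 → X = 0

theorem IsConnection.separatesFibers [IsManifold 𝓘(ℝ, EP) ∞ P] {Θ : OneForm EP P EG}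
    (hΘ : IsConnection G Θ) : SeparatesFibers (EG := EG) G Θ where
  kernel_invariant g y v hv := by rw [hΘ.equivariant, hv, map_zero]
  fundamental y X hX := by rwa [hΘ.vertical] at hX

variable [LieGroup 𝓘(ℝ, EG) ∞ G]

theorem contMDiff_mul_const (g : G) : ContMDiff 𝓘(ℝ, EG) 𝓘(ℝ, EG) ∞ (fun k : G => k * g) :=
  (contMDiff_mul 𝓘(ℝ, EG) ∞).comp (contMDiff_id.prodMk contMDiff_const)

/-- Right translation of tangent vectors of `G` to the Lie algebra. -/
def rightTranslation (g : G) : TangentSpace 𝓘(ℝ, EG) g →L[ℝ] EG :=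
  mfderiv 𝓘(ℝ, EG) 𝓘(ℝ, EG) (fun k : G => k * g⁻¹) g

theorem rightTranslation_injective (g : G) (w : TangentSpace 𝓘(ℝ, EG) g)
    (h : rightTranslation g w = 0) : w = 0 := by
  have h1 := mfderiv_comp_apply_of_eq (I := 𝓘(ℝ, EG)) (I' := 𝓘(ℝ, EG)) (I'' := 𝓘(ℝ, EG))
    (f := fun k : G => k * g⁻¹) (g := fun k : G => k * g) (x := g) (y := 1)
    ((contMDiff_mul_const g).mdifferentiableAt (by simp))
    ((contMDiff_mul_const g⁻¹).mdifferentiableAt (by simp)) (by simp) w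
  have h2 : ((fun k : G => k * g) ∘ fun k : G => k * g⁻¹) = id := by
    funext k; simp
  rw [h2, mfderiv_id] at h1
  let L : EG →L[ℝ] EG := mfderiv 𝓘(ℝ, EG) 𝓘(ℝ, EG) (fun k : G => k * g) 1
  exact h1.trans ((congrArg L h).trans (map_zero L))

/-- The orbit map factors as k • y = (k g⁻¹) • (g • y), which moves the base point to 1. The sign
comes from the convention exp(-tX) in the fundamental vector field. -/
theorem mfderiv_orbit_apply (hs : SmoothAction EG G EP P) (g : G) (y : P)
    (w : TangentSpace 𝓘(ℝ, EG) g) :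
    mfderiv 𝓘(ℝ, EG) 𝓘(ℝ, EP) (fun k : G => k • y) g w =
      -fundamentalVector EG G (g • y) (rightTranslation g w) := by
  have h1 := mfderiv_comp_apply_of_eq (I := 𝓘(ℝ, EG)) (I' := 𝓘(ℝ, EG)) (I'' := 𝓘(ℝ, EP))
    (f := fun k : G => k * g⁻¹) (g := fun k : G => k • (g • y)) (x := g) (y := 1)
    ((hs.contMDiff_orbit (g • y)).mdifferentiableAt (by simp))
    ((contMDiff_mul_const g⁻¹).mdifferentiableAt (by simp)) (by simp) w
  have h2 : ((fun k : G => k • (g • y)) ∘ fun k : G => k * g⁻¹) = fun k : G => k • y := by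
    funext k; simp [smul_smul]
  rw [h2] at h1
  refine Eq.trans h1 ?_
  exact (neg_neg (mfderiv 𝓘(ℝ, EG) 𝓘(ℝ, EP) (fun k : G => k • (g • y)) 1
    (rightTranslation (EG := EG) g w) : EP)).symm

theorem mfderiv_smul_apply (hs : SmoothAction EG G EP P) {h : X → G} {c : X → P} {x : X}
    (hh : MDifferentiableAt 𝓘(ℝ, EX) 𝓘(ℝ, EG) h x)
    (hc : MDifferentiableAt 𝓘(ℝ, EX) 𝓘(ℝ, EP) c x) (v : TangentSpace 𝓘(ℝ, EX) x) :
    mfderiv 𝓘(ℝ, EX) 𝓘(ℝ, EP) (fun z => h z • c z) x v =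
      -fundamentalVector EG G (h x • c x)
        (rightTranslation (h x) (mfderiv 𝓘(ℝ, EX) 𝓘(ℝ, EG) h x v)) +
      mfderiv 𝓘(ℝ, EP) 𝓘(ℝ, EP) (fun y => h x • y) (c x)
        (mfderiv 𝓘(ℝ, EX) 𝓘(ℝ, EP) c x v) := by
  rw [← mfderiv_orbit_apply hs]
  exact mfderiv_comp_prodMk_apply (f := fun z : G × P => z.1 • z.2)
    (ContMDiff.mdifferentiableAt hs (by simp)) hh hc v

theorem pullbackForm_smul_apply (hs : SmoothAction EG G EP P) (α : OneForm EP P V)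
    {h : X → G} {c : X → P} {x : X}
    (hh : MDifferentiableAt 𝓘(ℝ, EX) 𝓘(ℝ, EG) h x)
    (hc : MDifferentiableAt 𝓘(ℝ, EX) 𝓘(ℝ, EP) c x) (v : TangentSpace 𝓘(ℝ, EX) x) :
    pullbackForm (fun z => h z • c z) α x v =
      -α (h x • c x) (fundamentalVector EG G (h x • c x)
        (rightTranslation (h x) (mfderiv 𝓘(ℝ, EX) 𝓘(ℝ, EG) h x v))) +
      pullbackForm (fun y => h x • y) α (c x) (mfderiv 𝓘(ℝ, EX) 𝓘(ℝ, EP) c x v) := by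
  have := congrArg (α (h x • c x)) (mfderiv_smul_apply hs hh hc v)
  rw [map_add, map_neg] at this
  exact this

/-- In the Leibniz rule the term from `h` is vertical, hence killed, and the translation by `h x` is
absorbed by invariance. Thus a basic form does not see a change of gauge. -/
theorem IsBasicForm.pullbackForm_smul_apply {α : OneForm EP P V}
    (hα : IsBasicForm (EG := EG) G α) (hs : SmoothAction EG G EP P)
    {h : X → G} {c : X → P} {x : X}
    (hh : MDifferentiableAt 𝓘(ℝ, EX) 𝓘(ℝ, EG) h x)
    (hc : MDifferentiableAt 𝓘(ℝ, EX) 𝓘(ℝ, EP) c x) (v : TangentSpace 𝓘(ℝ, EX) x) :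
    pullbackForm (fun z => h z • c z) α x v = pullbackForm c α x v := by
  rw [EquivHol.pullbackForm_smul_apply hs α hh hc, hα.fundamental, neg_zero, zero_add,
    hα.invariant]
  rfl

/-- Infinitesimal uniqueness of horizontal lifts: when `c` and `h • c` are both horizontal, the
Leibniz rule leaves only the vertical term coming from `h`, which the form detects. -/
theorem SeparatesFibers.mfderiv_eq_zero {α : OneForm EP P V}
    (hα : SeparatesFibers (EG := EG) G α) (hs : SmoothAction EG G EP P)
    {h : X → G} {c : X → P} {x : X}
    (hh : MDifferentiableAt 𝓘(ℝ, EX) 𝓘(ℝ, EG) h x)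
    (hc : MDifferentiableAt 𝓘(ℝ, EX) 𝓘(ℝ, EP) c x) {v : TangentSpace 𝓘(ℝ, EX) x}
    (h1 : pullbackForm c α x v = 0) (h2 : pullbackForm (fun z => h z • c z) α x v = 0) :
    mfderiv 𝓘(ℝ, EX) 𝓘(ℝ, EG) h x v = 0 := by
  have h3 : pullbackForm (fun y => h x • y) α (c x) (mfderiv 𝓘(ℝ, EX) 𝓘(ℝ, EP) c x v) = 0 :=
    hα.kernel_invariant _ _ _ h1
  rw [pullbackForm_smul_apply hs α hh hc, h3, add_zero, neg_eq_zero] at h2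
  exact rightTranslation_injective _ _ (hα.fundamental _ _ h2)

end Action

/-! ### The Lie algebra of the circle -/

section CircleAction

variable {EP : Type*} [NormedAddCommGroup EP] [NormedSpace ℝ EP]
  {P : Type*} [TopologicalSpace P] [ChartedSpace EP P] [MulAction Circle P]

instance lieGroupCircle : LieGroup 𝓘(ℝ, EuclideanSpace ℝ (Fin 1)) ∞ Circle :=
  LieGroup.of_le (n := ω) le_top

/-- The derivative at `0` of the exponential map of the circle. -/
def circleGenerator : EuclideanSpace ℝ (Fin 1) :=
  mfderiv 𝓘(ℝ, ℝ) 𝓘(ℝ, EuclideanSpace ℝ (Fin 1)) Circle.exp 0 (1 : ℝ)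

/-- Followed by the inclusion into ℂ the exponential is exp(it), whose derivative at 0 is i. -/
theorem circleGenerator_ne_zero : circleGenerator ≠ 0 := by
  intro h
  have : Fact (Module.finrank ℝ ℂ = 1 + 1) := Complex.finrank_real_complex_fact
  have hc : ContMDiff 𝓘(ℝ, EuclideanSpace ℝ (Fin 1)) 𝓘(ℝ, ℂ) 1
      (fun u : Circle => (u : ℂ)) := contMDiff_coe_sphere (E := ℂ)
  have h1 := mfderiv_comp_apply (I := 𝓘(ℝ, ℝ)) (I' := 𝓘(ℝ, EuclideanSpace ℝ (Fin 1)))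
    (I'' := 𝓘(ℝ, ℂ)) (f := Circle.exp) (g := fun u : Circle => (u : ℂ)) (x := 0)
    (hc.mdifferentiableAt one_ne_zero)
    ((contMDiff_circleExp (m := 1)).mdifferentiableAt one_ne_zero) (1 : ℝ)
  have h2 : mfderiv 𝓘(ℝ, ℝ) 𝓘(ℝ, ℂ) ((fun u : Circle => (u : ℂ)) ∘ Circle.exp) 0 (1 : ℝ)
      = (0 : ℂ) :=
    h1.trans ((congrArg (mfderiv 𝓘(ℝ, EuclideanSpace ℝ (Fin 1)) 𝓘(ℝ, ℂ)
      (fun u : Circle => (u : ℂ)) (Circle.exp 0)) h).trans (map_zero _))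
  have h3 : HasDerivAt (fun t : ℝ => Complex.exp (t * Complex.I)) Complex.I 0 := by
    have := ((hasDerivAt_id (0 : ℂ)).mul_const Complex.I).cexp.comp_ofReal
    simpa using this
  have h4 : ((fun u : Circle => (u : ℂ)) ∘ Circle.exp) =
      fun t : ℝ => Complex.exp (t * Complex.I) := by
    funext t; simp
  rw [h4, mfderiv_eq_fderiv] at h2
  have h5 : fderiv ℝ (fun t : ℝ => Complex.exp (t * Complex.I)) 0 (1 : ℝ) = Complex.I := by
    rw [fderiv_apply_one_eq_deriv]; exact h3.deriv
  exact Complex.I_ne_zero (h5.symm.trans h2)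

theorem circleVector_eq (hs : SmoothAction (EuclideanSpace ℝ (Fin 1)) Circle EP P) (y : P) :
    (circleVector y : TangentSpace 𝓘(ℝ, EP) y) =
      -fundamentalVector (EuclideanSpace ℝ (Fin 1)) Circle y circleGenerator := by
  have h1 := mfderiv_comp_apply_of_eq (I := 𝓘(ℝ, ℝ)) (I' := 𝓘(ℝ, EuclideanSpace ℝ (Fin 1)))
    (I'' := 𝓘(ℝ, EP)) (f := Circle.exp) (g := fun u : Circle => u • y) (x := 0) (y := 1)
    ((hs.contMDiff_orbit y).mdifferentiableAt (by simp))
    ((contMDiff_circleExp (m := 1)).mdifferentiableAt one_ne_zero) Circle.exp_zero (1 : ℝ)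
  exact h1.trans (neg_neg (mfderiv 𝓘(ℝ, EuclideanSpace ℝ (Fin 1)) 𝓘(ℝ, EP)
    (fun u : Circle => u • y) 1 circleGenerator : EP)).symm

/-- The Lie algebra of U(1) is a line spanned by `circleGenerator`, on which Ξ is known from its
value i on the generating field. -/
theorem IsCircleConnection.separatesFibers [IsManifold 𝓘(ℝ, EP) ∞ P] {Ξ : OneForm EP P ℂ}
    (hΞ : IsCircleConnection Ξ)
    (hs : SmoothAction (EuclideanSpace ℝ (Fin 1)) Circle EP P) :
    SeparatesFibers (EG := EuclideanSpace ℝ (Fin 1)) Circle Ξ where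
  kernel_invariant u y v hv := by rw [hΞ.invariant, hv]
  fundamental y X hX := by
    obtain ⟨r, hr⟩ := exists_smul_eq_of_finrank_eq_one
      (finrank_euclideanSpace_fin (𝕜 := ℝ) (n := 1)) circleGenerator_ne_zero X
    have h1 := hΞ.vertical y
    rw [circleVector_eq hs, map_neg] at h1
    have h2 : (fundamentalVector (EuclideanSpace ℝ (Fin 1)) Circle y X :
        TangentSpace 𝓘(ℝ, EP) y) =
        r • fundamentalVector (EuclideanSpace ℝ (Fin 1)) Circle y circleGenerator := by
      rw [← hr]; exact map_smul _ r circleGenerator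
    rw [h2, map_smul, ← neg_neg (Ξ y _), h1] at hX
    have : r = 0 := by simpa using hX
    rw [← hr, this, zero_smul]

end CircleAction

/-! ### Local trivializations and descent of smoothness -/

section LocalTrivialization

variable {EK : Type*} [NormedAddCommGroup EK] [NormedSpace ℝ EK]
  {K : Type*} [TopologicalSpace K] [ChartedSpace EK K] [Group K]
  {EP : Type*} [NormedAddCommGroup EP] [NormedSpace ℝ EP]
  {P : Type*} [TopologicalSpace P] [ChartedSpace EP P] [MulAction K P]
  {EB : Type*} [NormedAddCommGroup EB] [NormedSpace ℝ EB]
  {B : Type*} [TopologicalSpace B] [ChartedSpace EB B]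
  {EN : Type*} [NormedAddCommGroup EN] [NormedSpace ℝ EN]
  {N : Type*} [TopologicalSpace N] [ChartedSpace EN N]

/-- A local trivialization of `p : P → B` over `U`, given by a smooth equivariant coordinate `κ`
along the fibres and the smooth section `s` on which `κ = 1`. -/
structure IsLocalTrivialization (EK EP EB : Type*) [NormedAddCommGroup EK] [NormedSpace ℝ EK]
    [NormedAddCommGroup EP] [NormedSpace ℝ EP] [NormedAddCommGroup EB] [NormedSpace ℝ EB]
    [ChartedSpace EK K] [ChartedSpace EP P] [ChartedSpace EB B]
    (p : P → B) (U : Set B) (κ : P → K) (s : B → P) : Prop where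
  isOpen : IsOpen U
  contMDiffOn_coord : ContMDiffOn 𝓘(ℝ, EP) 𝓘(ℝ, EK) ∞ κ (p ⁻¹' U)
  contMDiffOn_section : ContMDiffOn 𝓘(ℝ, EB) 𝓘(ℝ, EP) ∞ s U
  proj_section : ∀ b ∈ U, p (s b) = b
  coord_smul : ∀ y, p y ∈ U → ∀ k : K, κ (k • y) = k * κ y
  coord_smul_section : ∀ y, p y ∈ U → κ y • s (p y) = y

theorem IsLocalTrivialization.coord_section {p : P → B} {U : Set B} {κ : P → K} {s : B → P}
    (h : IsLocalTrivialization EK EP EB p U κ s) {b : B} (hb : b ∈ U) : κ (s b) = 1 := by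
  have h0 : p (s b) ∈ U := by rwa [h.proj_section b hb]
  have h1 := h.coord_smul_section (s b) h0
  rw [h.proj_section b hb] at h1
  have h2 := h.coord_smul (s b) h0 (κ (s b))
  rw [h1] at h2
  exact (mul_eq_left.1 h2.symm)

theorem IsPrincipalBundle.exists_isLocalTrivialization {p : P → B}
    (h : IsPrincipalBundle (EK := EK) (EP := EP) (EB := EB) K p) (b : B) :
    ∃ U κ s, b ∈ U ∧ IsLocalTrivialization (K := K) EK EP EB p U κ s := by
  obtain ⟨U, hU, hb, e, hsrc, htgt, he, hes, hey⟩ := h.locally_trivial b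
  have hmem : ∀ b ∈ U, ((b, 1) : B × K) ∈ e.target := fun b hb => by simp [htgt, hb]
  have hproj : ∀ z ∈ e.target, p (e.symm z) = z.1 := fun z hz => by
    rw [← (hey _ (e.map_target hz)).1, e.right_inv hz]
  refine ⟨U, fun y => (e y).2, fun b => e.symm (b, 1), hb, hU, ?_, ?_, ?_, ?_, ?_⟩
  · rw [← hsrc]
    exact contMDiff_snd.comp_contMDiffOn he
  · exact hes.comp (contMDiff_id.prodMk contMDiff_const).contMDiffOn hmem
  · exact fun b hb => hproj _ (hmem b hb)
  · exact fun y hy k => (hey y (by rw [hsrc]; exact hy)).2 k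
  · intro y hy
    have hys : y ∈ e.source := by rw [hsrc]; exact hy
    have h1 : e.symm (p y, 1) ∈ e.source := e.map_target (hmem _ hy)
    have hp1 : p (e.symm (p y, 1)) = p y := hproj _ (hmem _ hy)
    refine e.injOn ?_ hys ?_
    · rw [hsrc, mem_preimage, h.proj_smul, hp1]; exact hy
    · refine Prod.ext ?_ ?_
      · rw [(hey _ _).1, (hey _ hys).1, h.proj_smul, hp1]
        rw [hsrc, mem_preimage, h.proj_smul, hp1]; exact hy
      · rw [(hey _ h1).2, e.right_inv (hmem _ hy), mul_one]

/-- The bundle chart is y ↦ (p y, κ y), with inverse (b, k) ↦ k • s b. To build a principal bundle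
it therefore suffices to give fibre coordinates and sections. -/
theorem isPrincipalBundle_of_isLocalTrivialization {p : P → B}
    (hs : SmoothAction EK K EP P) (hp : ContMDiff 𝓘(ℝ, EP) 𝓘(ℝ, EB) ∞ p)
    (hpK : ∀ (k : K) (y : P), p (k • y) = p y)
    (h : ∀ b : B, ∃ U κ s, b ∈ U ∧ IsLocalTrivialization (K := K) EK EP EB p U κ s) :
    IsPrincipalBundle (EK := EK) (EP := EP) (EB := EB) K p where
  contMDiff_smul := hs
  contMDiff_proj := hp
  proj_smul := hpK
  locally_trivial b := by
    obtain ⟨U, κ, s, hb, ht⟩ := h b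
    have h1 : ContMDiffOn 𝓘(ℝ, EP) (𝓘(ℝ, EB).prod 𝓘(ℝ, EK)) ∞ (fun y => (p y, κ y))
        (p ⁻¹' U) := hp.contMDiffOn.prodMk ht.contMDiffOn_coord
    have h2 : ContMDiffOn (𝓘(ℝ, EB).prod 𝓘(ℝ, EK)) 𝓘(ℝ, EP) ∞
        (fun z : B × K => z.2 • s z.1) (U ×ˢ univ) :=
      ContMDiff.comp_contMDiffOn (g := fun z : K × P => z.1 • z.2)
        (f := fun z : B × K => (z.2, s z.1)) hs
        (contMDiff_snd.contMDiffOn.prodMk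
          (ht.contMDiffOn_section.comp contMDiff_fst.contMDiffOn fun z hz => hz.1))
    refine ⟨U, ht.isOpen, hb,
      { toFun := fun y => (p y, κ y)
        invFun := fun z => z.2 • s z.1
        source := p ⁻¹' U
        target := U ×ˢ univ
        map_source' := fun y hy => ⟨hy, mem_univ _⟩
        map_target' := fun z hz => by
          rw [mem_preimage, hpK, ht.proj_section _ hz.1]; exact hz.1
        left_inv' := fun y hy => ht.coord_smul_section y hy
        right_inv' := fun z hz => by
          refine Prod.ext ?_ ?_
          · exact (hpK _ _).trans (ht.proj_section _ hz.1)
          · refine (ht.coord_smul _ ?_ _).trans ?_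
            · rw [ht.proj_section _ hz.1]; exact hz.1
            · rw [ht.coord_section hz.1, mul_one]
        open_source := ht.isOpen.preimage hp.continuous
        open_target := ht.isOpen.prod isOpen_univ
        continuousOn_toFun := h1.continuousOn
        continuousOn_invFun := h2.continuousOn }, rfl, rfl, h1, h2, ?_⟩
    exact fun y hy => ⟨rfl, fun k => ht.coord_smul y hy k⟩

namespace IsPrincipalBundle

variable {p : P → B} (h : IsPrincipalBundle (EK := EK) (EP := EP) (EB := EB) K p)
include h

theorem surjective : Function.Surjective p := fun b => by
  obtain ⟨U, κ, s, hb, ht⟩ := h.exists_isLocalTrivialization b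
  exact ⟨s b, ht.proj_section b hb⟩

theorem exists_smul_eq {y z : P} (hyz : p y = p z) : ∃ k : K, z = k • y := by
  obtain ⟨U, κ, s, hb, ht⟩ := h.exists_isLocalTrivialization (p y)
  refine ⟨κ z * (κ y)⁻¹, ?_⟩
  rw [mul_smul, inv_smul_eq_iff.2 (ht.coord_smul_section y hb).symm, hyz,
    ht.coord_smul_section z (hyz ▸ hb)]

theorem smul_right_injective (y : P) : Function.Injective fun k : K => k • y := by
  intro k l hkl
  obtain ⟨U, κ, s, hb, ht⟩ := h.exists_isLocalTrivialization (p y)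
  have h1 := congrArg κ hkl
  simp only [ht.coord_smul y hb] at h1
  exact mul_right_cancel h1

/-- Locally f = (f ∘ p) ∘ s for a smooth section s. -/
theorem contMDiffOn_of_comp {f : B → N} {V : Set B} (hV : IsOpen V)
    (hf : ContMDiffOn 𝓘(ℝ, EP) 𝓘(ℝ, EN) ∞ (f ∘ p) (p ⁻¹' V)) :
    ContMDiffOn 𝓘(ℝ, EB) 𝓘(ℝ, EN) ∞ f V := by
  intro b hbV
  obtain ⟨U, κ, s, hb, ht⟩ := h.exists_isLocalTrivialization b
  have hUV : IsOpen (U ∩ V) := ht.isOpen.inter hV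
  have h1 : ContMDiffOn 𝓘(ℝ, EB) 𝓘(ℝ, EN) ∞ ((f ∘ p) ∘ s) (U ∩ V) :=
    hf.comp (ht.contMDiffOn_section.mono inter_subset_left) fun z hz => by
      rw [mem_preimage, mem_preimage, ht.proj_section z hz.1]; exact hz.2
  have h2 : ContMDiffOn 𝓘(ℝ, EB) 𝓘(ℝ, EN) ∞ f (U ∩ V) := h1.congr fun z hz => by
    simp only [Function.comp, ht.proj_section z hz.1]
  exact (h2.contMDiffAt (hUV.mem_nhds ⟨hb, hbV⟩)).contMDiffWithinAt

theorem contMDiff_of_comp {f : B → N} (hf : ContMDiff 𝓘(ℝ, EP) 𝓘(ℝ, EN) ∞ (f ∘ p)) :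
    ContMDiff 𝓘(ℝ, EB) 𝓘(ℝ, EN) ∞ f :=
  contMDiffOn_univ.1 (h.contMDiffOn_of_comp isOpen_univ hf.contMDiffOn)

end IsPrincipalBundle

end LocalTrivialization

/-! ### Orbit spaces -/

section Orbits

variable {G : Type*} [Group G] {M : Type*} [MulAction G M] {P : Type*} [MulAction G P]

theorem quotientMap_surjective : Function.Surjective (quotientMap G : P → Orbits G P) :=
  Quotient.mk_surjective

theorem quotientMap_smul (g : G) (y : P) : quotientMap G (g • y) = quotientMap G y :=
  Quotient.sound ⟨g, rfl⟩

theorem exists_smul_eq_of_quotientMap_eq {y z : P} (h : quotientMap G y = quotientMap G z) :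
    ∃ g : G, g • z = y :=
  Quotient.exact h

theorem quotientProj_quotientMap (p : P → M) (hpG : ∀ (g : G) (y : P), p (g • y) = g • p y)
    (y : P) : quotientProj G p hpG (quotientMap G y) = quotientMap G (p y) :=
  rfl

theorem quotientMap_circle_smul [MulAction Circle P] [SMulCommClass G Circle P] (u : Circle)
    (y : P) : u • quotientMap G y = quotientMap G (u • y) :=
  rfl

end Orbits

/-! ### The principal U(1)-bundle P/G → M/G -/

section QuotientBundle

variable {EG : Type*} [NormedAddCommGroup EG] [NormedSpace ℝ EG]
  {G : Type*} [TopologicalSpace G] [ChartedSpace EG G] [Group G]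
  {EM : Type*} [NormedAddCommGroup EM] [NormedSpace ℝ EM]
  {M : Type*} [TopologicalSpace M] [ChartedSpace EM M] [MulAction G M]
  {EP : Type*} [NormedAddCommGroup EP] [NormedSpace ℝ EP]
  {P : Type*} [TopologicalSpace P] [ChartedSpace EP P]
  [MulAction G P] [MulAction Circle P] [SMulCommClass G Circle P]
  {EMG : Type*} [NormedAddCommGroup EMG] [NormedSpace ℝ EMG] [ChartedSpace EMG (Orbits G M)]
  {EPG : Type*} [NormedAddCommGroup EPG] [NormedSpace ℝ EPG] [ChartedSpace EPG (Orbits G P)]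

theorem smoothAction_orbits (hs : SmoothAction (EuclideanSpace ℝ (Fin 1)) Circle EP P)
    (hP : IsPrincipalBundle (EP := EP) (EB := EPG) (EK := EG) G
      (quotientMap G : P → Orbits G P)) :
    SmoothAction (EuclideanSpace ℝ (Fin 1)) Circle EPG (Orbits G P) := by
  rintro ⟨u, b⟩
  obtain ⟨U, κ, s, hb, ht⟩ := hP.exists_isLocalTrivialization b
  have h1 : ContMDiffOn (𝓘(ℝ, EuclideanSpace ℝ (Fin 1)).prod 𝓘(ℝ, EPG)) 𝓘(ℝ, EPG) ∞
      (fun z : Circle × Orbits G P => quotientMap G (z.1 • s z.2)) (univ ×ˢ U) :=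
    hP.contMDiff_proj.comp_contMDiffOn
      (ContMDiff.comp_contMDiffOn (g := fun z : Circle × P => z.1 • z.2)
        (f := fun z : Circle × Orbits G P => (z.1, s z.2)) hs
        (contMDiff_fst.contMDiffOn.prodMk
          (ht.contMDiffOn_section.comp contMDiff_snd.contMDiffOn fun z hz => hz.2)))
  have h2 : ContMDiffOn (𝓘(ℝ, EuclideanSpace ℝ (Fin 1)).prod 𝓘(ℝ, EPG)) 𝓘(ℝ, EPG) ∞
      (fun z : Circle × Orbits G P => z.1 • z.2) (univ ×ˢ U) := h1.congr fun z hz => by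
    rw [← quotientMap_circle_smul, ht.proj_section _ hz.2]
  exact h2.contMDiffAt ((isOpen_univ.prod ht.isOpen).mem_nhds ⟨mem_univ _, hb⟩)

variable [LieGroup 𝓘(ℝ, EG) ∞ G]

/-- Over a section `s` of M → M/G every orbit in P has exactly one point in each G-direction lying
over `s`, namely `r y`; so P/G is locally the pull-back of P along `s`, and a trivialization `μ`,
`σ` of P near `s b` carries over. -/
theorem isPrincipalBundle_quotientProj {p : P → M}
    (hp : IsPrincipalBundle (EP := EP) (EB := EM) (EK := EuclideanSpace ℝ (Fin 1)) Circle p)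
    (hpG : ∀ (g : G) (y : P), p (g • y) = g • p y)
    (hM : IsPrincipalBundle (EP := EM) (EB := EMG) (EK := EG) G
      (quotientMap G : M → Orbits G M))
    (hP : IsPrincipalBundle (EP := EP) (EB := EPG) (EK := EG) G
      (quotientMap G : P → Orbits G P)) :
    IsPrincipalBundle (EP := EPG) (EB := EMG) (EK := EuclideanSpace ℝ (Fin 1))
      Circle (quotientProj G p hpG) := by
  have hproj : ContMDiff 𝓘(ℝ, EPG) 𝓘(ℝ, EMG) ∞ (quotientProj G p hpG) :=
    hP.contMDiff_of_comp (hM.contMDiff_proj.comp hp.contMDiff_proj)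
  refine isPrincipalBundle_of_isLocalTrivialization
    (smoothAction_orbits hp.contMDiff_smul hP) hproj ?_ ?_
  · intro u z
    obtain ⟨y, rfl⟩ := quotientMap_surjective z
    rw [quotientMap_circle_smul, quotientProj_quotientMap, hp.proj_smul,
      quotientProj_quotientMap]
  · intro b
    obtain ⟨U, κ, s, hb, ht⟩ := hM.exists_isLocalTrivialization b
    obtain ⟨W, μ, σ, hW, hσ⟩ := hp.exists_isLocalTrivialization (s b)
    have hV : IsOpen (U ∩ s ⁻¹' W) :=
      ht.contMDiffOn_section.continuousOn.isOpen_inter_preimage ht.isOpen hσ.isOpen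
    -- the representative of the orbit of `y` which lies over the section `s`
    let r : P → P := fun y => (κ (p y))⁻¹ • y
    have hr : ∀ y, quotientMap G (p y) ∈ U → p (r y) = s (quotientMap G (p y)) := fun y hy => by
      rw [hpG, inv_smul_eq_iff, ht.coord_smul_section _ hy]
    have hrG : ∀ y, quotientMap G (p y) ∈ U → ∀ g : G, r (g • y) = r y := fun y hy g => by
      simp only [r]
      rw [hpG, ht.coord_smul _ hy, mul_inv_rev, mul_smul, inv_smul_smul]
    have hrs : ContMDiffOn 𝓘(ℝ, EP) 𝓘(ℝ, EP) ∞ r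
        (quotientMap G ⁻¹' (quotientProj G p hpG ⁻¹' (U ∩ s ⁻¹' W))) := by
      refine ContMDiff.comp_contMDiffOn (g := fun z : G × P => z.1 • z.2)
        (f := fun y => ((κ (p y))⁻¹, y)) hP.contMDiff_smul (ContMDiffOn.prodMk ?_ contMDiffOn_id)
      exact (contMDiff_inv 𝓘(ℝ, EG) ∞).comp_contMDiffOn
        (ht.contMDiffOn_coord.comp hp.contMDiff_proj.contMDiffOn fun y hy => hy.1)
    -- `Quotient.out` picks an arbitrary representative, not a smooth one. This is harmless since
    -- `r` is constant on orbits, and smoothness is tested after pulling back to P.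
    have hκ : ∀ y, quotientMap G (p y) ∈ U → μ (r (quotientMap G y).out) = μ (r y) := by
      intro y hy
      obtain ⟨g, hg⟩ := exists_smul_eq_of_quotientMap_eq (G := G)
        (Quotient.out_eq (quotientMap G y))
      rw [← hg, hrG y hy]
    refine ⟨U ∩ s ⁻¹' W, fun z => μ (r z.out), fun c => quotientMap G (σ (s c)), ⟨hb, hW⟩,
      hV, ?_, ?_, ?_, ?_, ?_⟩
    · refine hP.contMDiffOn_of_comp (hV.preimage hproj.continuous) ?_
      refine (hσ.contMDiffOn_coord.comp hrs fun y hy => ?_).congr fun y hy => hκ y hy.1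
      rw [mem_preimage, mem_preimage, hr y hy.1]
      exact hy.2
    · exact hP.contMDiff_proj.comp_contMDiffOn (hσ.contMDiffOn_section.comp
        (ht.contMDiffOn_section.mono inter_subset_left) fun c hc => hc.2)
    · intro c hc
      rw [quotientProj_quotientMap, hσ.proj_section _ hc.2, ht.proj_section _ hc.1]
    · intro z hz u
      obtain ⟨y, rfl⟩ := quotientMap_surjective z
      have hy : quotientMap G (p y) ∈ U := hz.1
      have h1 : r (u • y) = u • r y := by
        simp only [r]
        rw [hp.proj_smul, smul_comm]
      rw [quotientMap_circle_smul, hκ _ (by rwa [hp.proj_smul]), hκ y hy, h1,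
        hσ.coord_smul]
      rw [hr y hy]
      exact hz.2
    · intro z hz
      obtain ⟨y, rfl⟩ := quotientMap_surjective z
      have hy : quotientMap G (p y) ∈ U := hz.1
      have h1 : p (r y) ∈ W := by
        rw [hr y hy]
        exact hz.2
      rw [hκ y hy, quotientProj_quotientMap, ← hr y hy, quotientMap_circle_smul,
        hσ.coord_smul_section _ h1]
      exact quotientMap_smul _ _

end QuotientBundle

/-! ### Tangent vectors as points of the tangent bundle -/

section TangentVectors

variable {E : Type*} [NormedAddCommGroup E] [NormedSpace ℝ E]
  {M : Type*} [TopologicalSpace M] [ChartedSpace E M]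
  {V : Type*} [NormedAddCommGroup V] [NormedSpace ℝ V]

theorem formMap_mk_congr (α : OneForm E M V) {x y : M} (h : x = y) (w : E) :
    formMap α (⟨x, w⟩ : TangentBundle 𝓘(ℝ, E) M) = α y w := by
  subst h
  rfl

/-- In the trivialization at `x` the inclusion of the fibre over `x` is a continuous linear map. -/
theorem contMDiff_tangentBundle_mk [IsManifold 𝓘(ℝ, E) 1 M] (x : M) {n : WithTop ℕ∞} :
    ContMDiff 𝓘(ℝ, E) 𝓘(ℝ, E).tangent n
      (fun v : E => (⟨x, v⟩ : TangentBundle 𝓘(ℝ, E) M)) := by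
  intro v
  rw [Bundle.contMDiffAt_totalSpace]
  refine ⟨contMDiffAt_const, ?_⟩
  let L : E →L[ℝ] E := (trivializationAt E (TangentSpace 𝓘(ℝ, E)) x).continuousLinearMapAt ℝ x
  have h1 : (fun v : E => ((trivializationAt E (TangentSpace 𝓘(ℝ, E) (M := M)) x)
      (⟨x, v⟩ : TangentBundle 𝓘(ℝ, E) M)).2) = L := by
    funext w
    exact (Bundle.Trivialization.continuousLinearMapAt_apply_of_mem ℝ
      (trivializationAt E (TangentSpace 𝓘(ℝ, E)) x)
      (FiberBundle.mem_baseSet_trivializationAt E (TangentSpace 𝓘(ℝ, E)) x) w).symm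
  exact h1 ▸ L.contMDiff.contMDiffAt

end TangentVectors

/-! ### The form Ξ(Θ), and why Ξ - Ξ(Θ) is basic -/

section FormOfConnections

variable {EG : Type*} [NormedAddCommGroup EG] [NormedSpace ℝ EG]
  {G : Type*} [TopologicalSpace G] [ChartedSpace EG G] [Group G] [LieGroup 𝓘(ℝ, EG) ∞ G]
  {EM : Type*} [NormedAddCommGroup EM] [NormedSpace ℝ EM]
  {M : Type*} [TopologicalSpace M] [ChartedSpace EM M] [MulAction G M]
  {EP : Type*} [NormedAddCommGroup EP] [NormedSpace ℝ EP]
  {P : Type*} [TopologicalSpace P] [ChartedSpace EP P] [MulAction G P]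

/-- A smooth form evaluated on the fundamental vector fields is smooth. -/
theorem IsSmoothForm.contMDiff_fundamentalVector {V : Type*} [NormedAddCommGroup V]
    [NormedSpace ℝ V] [IsManifold 𝓘(ℝ, EP) ∞ P] {Ξ : OneForm EP P V}
    (hΞ : IsSmoothForm Ξ) (hs : SmoothAction EG G EP P) :
    ContMDiff (𝓘(ℝ, EP).prod 𝓘(ℝ, EG)) 𝓘(ℝ, V) ∞
      (fun z : P × EG => Ξ z.1 (fundamentalVector EG G z.1 z.2)) := by
  have : IsManifold 𝓘(ℝ, EG) ∞ G := (inferInstance : ContMDiffMul 𝓘(ℝ, EG) ∞ G).toIsManifold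
  -- The fundamental vector of X at y is minus the image of (X at 1, 0 at y) under the tangent map
  -- of the action, so it depends smoothly on the pair (y, X).
  let T : P × EG → TangentBundle (𝓘(ℝ, EG).prod 𝓘(ℝ, EP)) (G × P) := fun z =>
    (equivTangentBundleProd 𝓘(ℝ, EG) G 𝓘(ℝ, EP) P).symm (⟨1, z.2⟩, ⟨z.1, 0⟩)
  have hT : ContMDiff (𝓘(ℝ, EP).prod 𝓘(ℝ, EG)) (𝓘(ℝ, EG).prod 𝓘(ℝ, EP)).tangent ∞ T := by
    refine contMDiff_equivTangentBundleProd_symm.comp (ContMDiff.prodMk ?_ ?_)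
    · exact (contMDiff_tangentBundle_mk (1 : G)).comp contMDiff_snd
    · exact (Bundle.contMDiff_zeroSection ℝ (TangentSpace 𝓘(ℝ, EP) (M := P))).comp
        contMDiff_fst
  have hA : ContMDiff (𝓘(ℝ, EG).prod 𝓘(ℝ, EP)).tangent 𝓘(ℝ, EP).tangent ∞
      (tangentMap (𝓘(ℝ, EG).prod 𝓘(ℝ, EP)) 𝓘(ℝ, EP) (fun z : G × P => z.1 • z.2)) :=
    ContMDiff.contMDiff_tangentMap hs (by simp)
  have h1 := (ContMDiff.comp hΞ (hA.comp hT)).neg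
  refine h1.congr fun z => ?_
  have h2 := mfderiv_prod_eq_add_apply (I := 𝓘(ℝ, EG)) (I' := 𝓘(ℝ, EP)) (I'' := 𝓘(ℝ, EP))
    (f := fun z : G × P => z.1 • z.2) (p := ((1 : G), z.1)) (v := (z.2, (0 : EP)))
    (ContMDiff.mdifferentiableAt hs (by simp))
  have h3 : mfderiv (𝓘(ℝ, EG).prod 𝓘(ℝ, EP)) 𝓘(ℝ, EP) (fun z : G × P => z.1 • z.2)
      ((1 : G), z.1) (z.2, (0 : EP)) = (-fundamentalVector EG G z.1 z.2 : EP) := by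
    let L : EP →L[ℝ] EP := mfderiv 𝓘(ℝ, EP) 𝓘(ℝ, EP) (fun y : P => (1 : G) • y) z.1
    let L' : EG →L[ℝ] EP := mfderiv 𝓘(ℝ, EG) 𝓘(ℝ, EP) (fun g : G => g • z.1) 1
    have h4 : L' z.2 + L 0 = -(-L' z.2) := by simp
    exact h2.trans h4
  -- The tangent map lands over `1 • y`, which has to be identified with `y`.
  have h5 := formMap_mk_congr Ξ (one_smul G z.1) (-fundamentalVector EG G z.1 z.2 : EP)
  have h6 : Ξ z.1 (-fundamentalVector EG G z.1 z.2 : EP) =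
      -Ξ z.1 (fundamentalVector EG G z.1 z.2) := map_neg (Ξ z.1) _
  rw [← neg_eq_iff_eq_neg.2 (h5.trans h6)]
  exact congrArg (fun w : EP => -formMap Ξ
    (⟨(1 : G) • z.1, w⟩ : TangentBundle 𝓘(ℝ, EP) P)) h3.symm

omit [MulAction G M] in
theorem isSmoothForm_formOfConnections [IsManifold 𝓘(ℝ, EP) ∞ P] [IsManifold 𝓘(ℝ, EM) ∞ M]
    {p : P → M} (hp : ContMDiff 𝓘(ℝ, EP) 𝓘(ℝ, EM) ∞ p) (hs : SmoothAction EG G EP P)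
    {Ξ : OneForm EP P ℂ} (hΞ : IsSmoothForm Ξ) {Θ : OneForm EM M EG} (hΘ : IsSmoothForm Θ) :
    IsSmoothForm (formOfConnections G p Ξ Θ) := by
  have h1 : ContMDiff 𝓘(ℝ, EP).tangent 𝓘(ℝ, EG) ∞
      (fun v : TangentBundle 𝓘(ℝ, EP) P => formMap Θ (tangentMap 𝓘(ℝ, EP) 𝓘(ℝ, EM) p v)) :=
    ContMDiff.comp hΘ (hp.contMDiff_tangentMap (by simp))
  exact (hΞ.contMDiff_fundamentalVector hs).comp
    ((Bundle.contMDiff_proj (TangentSpace 𝓘(ℝ, EP) (M := P))).prodMk h1)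

omit [LieGroup 𝓘(ℝ, EG) ∞ G] in
-- Differentiate p(k • y) = k • p(y) at k = 1.
theorem mfderiv_fundamentalVector {p : P → M} (hp : MDifferentiable 𝓘(ℝ, EP) 𝓘(ℝ, EM) p)
    (hpG : ∀ (g : G) (y : P), p (g • y) = g • p y) (hs : SmoothAction EG G EP P) (y : P)
    (X : EG) :
    mfderiv 𝓘(ℝ, EP) 𝓘(ℝ, EM) p y (fundamentalVector EG G y X) =
      fundamentalVector EG G (p y) X := by
  have h1 := mfderiv_comp_apply_of_eq (I := 𝓘(ℝ, EG)) (I' := 𝓘(ℝ, EP)) (I'' := 𝓘(ℝ, EM))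
    (f := fun k : G => k • y) (g := p) (x := 1) (y := y) (hp y)
    ((hs.contMDiff_orbit y).mdifferentiableAt (by simp)) (one_smul G y) X
  have h2 : (p ∘ fun k : G => k • y) = fun k : G => k • p y := funext fun k => hpG k y
  rw [h2] at h1
  let L : EP →L[ℝ] EM := mfderiv 𝓘(ℝ, EP) 𝓘(ℝ, EM) p y
  let L' : EG →L[ℝ] EP := mfderiv 𝓘(ℝ, EG) 𝓘(ℝ, EP) (fun g : G => g • y) 1
  exact (map_neg L (L' X)).trans (congrArg (fun w : EM => -w) h1.symm)

/-- Differentiate (g h g⁻¹) • (g • y) = g • (h • y) at h = 1. -/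
theorem fundamentalVector_Ad (hs : SmoothAction EG G EP P) (g : G) (y : P) (X : EG) :
    fundamentalVector EG G (g • y) (Ad EG g X) =
      mfderiv 𝓘(ℝ, EP) 𝓘(ℝ, EP) (fun z : P => g • z) y (fundamentalVector EG G y X) := by
  have hconj : ContMDiff 𝓘(ℝ, EG) 𝓘(ℝ, EG) ∞ (fun h : G => g * h * g⁻¹) :=
    (contMDiff_mul_const g⁻¹).comp ((contMDiff_mul 𝓘(ℝ, EG) ∞).comp
      (contMDiff_const.prodMk contMDiff_id))
  have h1 := mfderiv_comp_apply_of_eq (I := 𝓘(ℝ, EG)) (I' := 𝓘(ℝ, EG)) (I'' := 𝓘(ℝ, EP))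
    (f := fun h : G => g * h * g⁻¹) (g := fun k : G => k • (g • y)) (x := 1) (y := 1)
    ((hs.contMDiff_orbit _).mdifferentiableAt (by simp))
    (hconj.mdifferentiableAt (by simp)) (by simp) X
  have h2 := mfderiv_comp_apply_of_eq (I := 𝓘(ℝ, EG)) (I' := 𝓘(ℝ, EP)) (I'' := 𝓘(ℝ, EP))
    (f := fun k : G => k • y) (g := fun z : P => g • z) (x := 1) (y := y)
    ((hs.contMDiff_smul_left g).mdifferentiableAt (by simp))
    ((hs.contMDiff_orbit y).mdifferentiableAt (by simp)) (one_smul G y) X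
  have h3 : ((fun k : G => k • (g • y)) ∘ fun h : G => g * h * g⁻¹) =
      (fun z : P => g • z) ∘ fun k : G => k • y := by
    funext k; simp [smul_smul]
  rw [h3] at h1
  let L : EP →L[ℝ] EP := mfderiv 𝓘(ℝ, EP) 𝓘(ℝ, EP) (fun z : P => g • z) y
  let L' : EG →L[ℝ] EP := mfderiv 𝓘(ℝ, EG) 𝓘(ℝ, EP) (fun g : G => g • y) 1
  exact (congrArg (fun w : EP => -w) (h1.symm.trans h2)).trans (map_neg L (L' X)).symm

/-- Under translation by g the pull-back of Θ picks up Ad, which `fundamentalVector_Ad` turns back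
into a translation absorbed by the invariance of Ξ. On a fundamental vector Θ returns X, so Ξ and
Ξ(Θ) take the same value. -/
theorem isBasicForm_sub_formOfConnections [IsManifold 𝓘(ℝ, EM) ∞ M]
    {p : P → M} (hp : MDifferentiable 𝓘(ℝ, EP) 𝓘(ℝ, EM) p)
    (hpG : ∀ (g : G) (y : P), p (g • y) = g • p y) (hs : SmoothAction EG G EP P)
    (hsM : SmoothAction EG G EM M)
    {Ξ : OneForm EP P ℂ} (hΞ : IsInvariantForm G Ξ) {Θ : OneForm EM M EG}
    (hΘ : IsConnection G Θ) :
    IsBasicForm (EG := EG) G (Ξ - formOfConnections G p Ξ Θ) where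
  invariant g := by
    funext y
    refine ContinuousLinearMap.ext fun v => ?_
    have h1 : pullbackForm (fun z : P => g • z) Ξ y v = Ξ y v := by rw [hΞ g]
    have hg : MDifferentiableAt 𝓘(ℝ, EP) 𝓘(ℝ, EP) (fun z : P => g • z) y :=
      (hs.contMDiff_smul_left g).mdifferentiableAt (by simp)
    have h2 : pullbackForm (fun z : P => g • z) (pullbackForm (E := EP) p Θ) y v =
        Ad EG g (pullbackForm p Θ y v) := by
      rw [← pullbackForm_comp_apply (hp _) hg]
      have : (p ∘ fun z : P => g • z) = (fun z : M => g • z) ∘ p := funext fun z => hpG g z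
      rw [this, pullbackForm_comp_apply
        ((hsM.contMDiff_smul_left g).mdifferentiableAt (by simp)) (hp _)]
      exact hΘ.equivariant g (p y) _
    have h3 : pullbackForm (fun z : P => g • z) (formOfConnections G p Ξ Θ) y v =
        formOfConnections G p Ξ Θ y v := by
      have h4 : pullbackForm (fun z : P => g • z) (formOfConnections G p Ξ Θ) y v =
        Ξ (g • y) (fundamentalVector EG G (g • y)
          (pullbackForm (fun z : P => g • z) (pullbackForm (E := EP) p Θ) y v)) := rfl
      rw [h4, h2, fundamentalVector_Ad hs]
      exact congrArg (fun β : OneForm EP P ℂ =>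
        β y (fundamentalVector EG G y (pullbackForm p Θ y v))) (hΞ g)
    exact congrArg₂ (fun a b : ℂ => a - b) h1 h3
  fundamental y X := by
    have h1 : formOfConnections G p Ξ Θ y (fundamentalVector EG G y X) =
        Ξ y (fundamentalVector EG G y (Θ (p y) (mfderiv 𝓘(ℝ, EP) 𝓘(ℝ, EM) p y
          (fundamentalVector EG G y X)))) := rfl
    rw [mfderiv_fundamentalVector hp hpG hs, hΘ.vertical] at h1
    exact sub_eq_zero.2 h1.symm

end FormOfConnections

/-! ### Descent of basic forms along a principal bundle -/

section Descent

variable {EK : Type*} [NormedAddCommGroup EK] [NormedSpace ℝ EK]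
  {K : Type*} [TopologicalSpace K] [ChartedSpace EK K] [Group K]
  {EP : Type*} [NormedAddCommGroup EP] [NormedSpace ℝ EP]
  {P : Type*} [TopologicalSpace P] [ChartedSpace EP P] [MulAction K P]
  {EB : Type*} [NormedAddCommGroup EB] [NormedSpace ℝ EB]
  {B : Type*} [TopologicalSpace B] [ChartedSpace EB B]
  {V : Type*} [NormedAddCommGroup V] [NormedSpace ℝ V]
  {p : P → B}

/-- The descended form is the pull-back of α along a local section. Near y the map s ∘ p moves each
point by a group-valued function, to which a basic form is blind. The section may change from point
to point, as the identity is checked at one point at a time. -/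
theorem IsPrincipalBundle.exists_pullbackForm_eq [LieGroup 𝓘(ℝ, EK) ∞ K]
    (h : IsPrincipalBundle (EK := EK) (EP := EP) (EB := EB) K p) {α : OneForm EP P V}
    (hα : IsBasicForm (EG := EK) K α) : ∃ η : OneForm EB B V, pullbackForm p η = α := by
  choose U κ s hb ht using h.exists_isLocalTrivialization
  refine ⟨fun b => pullbackForm (s b) α b, ?_⟩
  funext y
  refine ContinuousLinearMap.ext fun v => ?_
  have hU : p ⁻¹' U (p y) ∈ nhds y :=
    ((ht (p y)).isOpen.preimage h.contMDiff_proj.continuous).mem_nhds (hb (p y))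
  have hp : MDifferentiableAt 𝓘(ℝ, EP) 𝓘(ℝ, EB) p y :=
    h.contMDiff_proj.mdifferentiableAt (by simp)
  have hs : MDifferentiableAt 𝓘(ℝ, EB) 𝓘(ℝ, EP) (s (p y)) (p y) :=
    ((ht (p y)).contMDiffOn_section.contMDiffAt
      ((ht (p y)).isOpen.mem_nhds (hb _))).mdifferentiableAt (by simp)
  have hκ : MDifferentiableAt 𝓘(ℝ, EP) 𝓘(ℝ, EK) (fun z => (κ (p y) z)⁻¹) y :=
    ((contMDiff_inv 𝓘(ℝ, EK) ∞).comp_contMDiffOn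
      (ht (p y)).contMDiffOn_coord |>.contMDiffAt hU).mdifferentiableAt (by simp)
  have h1 : (s (p y) ∘ p) =ᶠ[nhds y] fun z => (κ (p y) z)⁻¹ • id z :=
    Filter.mem_of_superset hU fun z hz =>
      eq_inv_smul_iff.2 ((ht (p y)).coord_smul_section z hz)
  calc pullbackForm p (fun b => pullbackForm (s b) α b) y v
      = pullbackForm p (pullbackForm (E := EB) (s (p y)) α) y v := rfl
    _ = pullbackForm (s (p y) ∘ p) α y v := (pullbackForm_comp_apply hs hp v).symm
    _ = pullbackForm (fun z => (κ (p y) z)⁻¹ • id z) α y v := pullbackForm_congr h1 v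
    _ = pullbackForm id α y v :=
      hα.pullbackForm_smul_apply h.contMDiff_smul hκ mdifferentiableAt_id v
    _ = α y v := by
      have : mfderiv 𝓘(ℝ, EP) 𝓘(ℝ, EP) (id : P → P) y v = v := by rw [mfderiv_id]; rfl
      exact congrArg (α y) this

theorem pullbackForm_projectForm {f : P → B} {α : OneForm EP P V}
    (h : ∃ η : OneForm EB B V, pullbackForm f η = α) :
    pullbackForm f (projectForm f α : OneForm EB B V) = α := by
  rw [projectForm, dif_pos h]
  exact h.choose_spec

theorem IsLocalTrivialization.pullbackForm_section {U : Set B} {κ : P → K} {s : B → P}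
    (ht : IsLocalTrivialization EK EP EB p U κ s) (hp : MDifferentiable 𝓘(ℝ, EP) 𝓘(ℝ, EB) p)
    (η : OneForm EB B V) {b : B} (hb : b ∈ U) (w : TangentSpace 𝓘(ℝ, EB) b) :
    pullbackForm s (pullbackForm (E := EP) p η) b w = η b w := by
  have hU : U ∈ nhds b := ht.isOpen.mem_nhds hb
  have h1 : (p ∘ s) =ᶠ[nhds b] id := Filter.mem_of_superset hU ht.proj_section
  rw [← pullbackForm_comp_apply (hp _)
    ((ht.contMDiffOn_section.contMDiffAt hU).mdifferentiableAt (by simp)), pullbackForm_congr h1]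
  have : mfderiv 𝓘(ℝ, EB) 𝓘(ℝ, EB) (id : B → B) b w = w := by rw [mfderiv_id]; rfl
  exact congrArg (η b) this

/-- Locally η is recovered as the pull-back along a smooth section of its own pull-back to P. -/
theorem IsPrincipalBundle.isSmoothForm_of_pullbackForm [IsManifold 𝓘(ℝ, EP) ∞ P]
    [IsManifold 𝓘(ℝ, EB) ∞ B]
    (h : IsPrincipalBundle (EK := EK) (EP := EP) (EB := EB) K p) {η : OneForm EB B V}
    (hη : IsSmoothForm (pullbackForm p η : OneForm EP P V)) : IsSmoothForm η := by
  rintro ⟨b, w⟩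
  obtain ⟨U, κ, s, hb, ht⟩ := h.exists_isLocalTrivialization b
  have hs := ht.contMDiffOn_section.contMDiffOn_tangentMapWithin (m := ∞) (by simp)
    ht.isOpen.uniqueMDiffOn
  have h1 := ContMDiff.comp_contMDiffOn hη hs
  have hopen : IsOpen (Bundle.TotalSpace.proj ⁻¹' U : Set (TangentBundle 𝓘(ℝ, EB) B)) :=
    ht.isOpen.preimage (FiberBundle.continuous_proj EB (TangentSpace 𝓘(ℝ, EB)))
  refine (h1.congr fun v hv => ?_).contMDiffAt (hopen.mem_nhds hb)
  have h2 : tangentMapWithin 𝓘(ℝ, EB) 𝓘(ℝ, EP) s U v = tangentMap 𝓘(ℝ, EB) 𝓘(ℝ, EP) s v :=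
    tangentMapWithin_eq_tangentMap (ht.isOpen.uniqueMDiffWithinAt hv)
      ((ht.contMDiffOn_section.contMDiffAt (ht.isOpen.mem_nhds hv)).mdifferentiableAt (by simp))
  rw [Function.comp_apply, h2]
  exact (ht.pullbackForm_section (h.contMDiff_proj.mdifferentiable (by simp)) η hv v.2).symm

/-- A local section translated so as to pass through `y` gives a right inverse of the derivative. -/
theorem IsPrincipalBundle.mfderiv_surjective
    (h : IsPrincipalBundle (EK := EK) (EP := EP) (EB := EB) K p) [LieGroup 𝓘(ℝ, EK) ∞ K]
    (y : P) (w : TangentSpace 𝓘(ℝ, EB) (p y)) :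
    ∃ v : TangentSpace 𝓘(ℝ, EP) y, mfderiv 𝓘(ℝ, EP) 𝓘(ℝ, EB) p y v = w := by
  obtain ⟨U, κ, s, hb, ht⟩ := h.exists_isLocalTrivialization (p y)
  have hU : U ∈ nhds (p y) := ht.isOpen.mem_nhds hb
  have h1 : (p ∘ fun b => κ y • s b) =ᶠ[nhds (p y)] id :=
    Filter.mem_of_superset hU fun b hb =>
      (h.proj_smul _ _).trans (ht.proj_section b hb)
  have hs : MDifferentiableAt 𝓘(ℝ, EB) 𝓘(ℝ, EP) (fun b => κ y • s b) (p y) :=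
    ((SmoothAction.contMDiff_smul_left h.contMDiff_smul (κ y)).comp_contMDiffOn
      ht.contMDiffOn_section |>.contMDiffAt hU).mdifferentiableAt (by simp)
  have h2 := mfderiv_comp_apply_of_eq (I := 𝓘(ℝ, EB)) (I' := 𝓘(ℝ, EP)) (I'' := 𝓘(ℝ, EB))
    (f := fun b => κ y • s b) (g := p) (x := p y) (y := y)
    (h.contMDiff_proj.mdifferentiableAt (by simp)) hs (ht.coord_smul_section y hb) w
  refine ⟨mfderiv 𝓘(ℝ, EB) 𝓘(ℝ, EP) (fun b => κ y • s b) (p y) w, h2.symm.trans ?_⟩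
  have h3 : (mfderiv 𝓘(ℝ, EB) 𝓘(ℝ, EB) (p ∘ fun b => κ y • s b) (p y) : EB →L[ℝ] EB) =
      mfderiv 𝓘(ℝ, EB) 𝓘(ℝ, EB) id (p y) := h1.mfderiv_eq
  rw [mfderiv_id] at h3
  exact congrArg (fun L : EB →L[ℝ] EB => L w) h3

end Descent

/-! ### The quotient connection on P/G -/

section QuotientConnection

variable {EG : Type*} [NormedAddCommGroup EG] [NormedSpace ℝ EG]
  {G : Type*} [TopologicalSpace G] [ChartedSpace EG G] [Group G] [LieGroup 𝓘(ℝ, EG) ∞ G]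
  {EM : Type*} [NormedAddCommGroup EM] [NormedSpace ℝ EM]
  {M : Type*} [TopologicalSpace M] [ChartedSpace EM M] [IsManifold 𝓘(ℝ, EM) ∞ M]
  [MulAction G M]
  {EP : Type*} [NormedAddCommGroup EP] [NormedSpace ℝ EP]
  {P : Type*} [TopologicalSpace P] [ChartedSpace EP P] [IsManifold 𝓘(ℝ, EP) ∞ P]
  [MulAction G P] [MulAction Circle P] [SMulCommClass G Circle P]
  {EPG : Type*} [NormedAddCommGroup EPG] [NormedSpace ℝ EPG]
  [ChartedSpace EPG (Orbits G P)] [IsManifold 𝓘(ℝ, EPG) ∞ (Orbits G P)]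

omit [IsManifold 𝓘(ℝ, EP) ∞ P] in
theorem mfderiv_circleVector {N : Type*} {EN : Type*} [NormedAddCommGroup EN] [NormedSpace ℝ EN]
    [TopologicalSpace N] [ChartedSpace EN N] {f : P → N}
    (hs : SmoothAction (EuclideanSpace ℝ (Fin 1)) Circle EP P)
    (hf : MDifferentiable 𝓘(ℝ, EP) 𝓘(ℝ, EN) f) (y : P) :
    mfderiv 𝓘(ℝ, EP) 𝓘(ℝ, EN) f y (circleVector y) =
      (velocity EN (fun t : ℝ => f (Circle.exp t • y)) 0 : EN) := by
  have hc : ContMDiff 𝓘(ℝ, ℝ) 𝓘(ℝ, EP) ∞ (fun t : ℝ => Circle.exp t • y) :=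
    (hs.contMDiff_orbit y).comp contMDiff_circleExp
  have h1 := mfderiv_comp_apply_of_eq (I := 𝓘(ℝ, ℝ)) (I' := 𝓘(ℝ, EP)) (I'' := 𝓘(ℝ, EN))
    (f := fun t : ℝ => Circle.exp t • y) (g := f) (x := 0) (y := y) (hf y)
    (hc.mdifferentiableAt (by simp)) (by simp) (1 : ℝ)
  exact h1.symm

omit [IsManifold 𝓘(ℝ, EP) ∞ P] [MulAction Circle P] [SMulCommClass G Circle P]
  [IsManifold 𝓘(ℝ, EPG) ∞ (Orbits G P)] in
theorem pullbackForm_quotientConnection {p : P → M}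
    (hp : MDifferentiable 𝓘(ℝ, EP) 𝓘(ℝ, EM) p)
    (hpG : ∀ (g : G) (y : P), p (g • y) = g • p y)
    (hsM : SmoothAction EG G EM M)
    (hP : IsPrincipalBundle (EP := EP) (EB := EPG) (EK := EG) G
      (quotientMap G : P → Orbits G P))
    {Ξ : OneForm EP P ℂ} (hΞ : IsInvariantForm G Ξ) {Θ : OneForm EM M EG}
    (hΘ : IsConnection G Θ) :
    pullbackForm (quotientMap G) (quotientConnection G p Ξ Θ EPG) =
      Ξ - formOfConnections G p Ξ Θ :=
  pullbackForm_projectForm (hP.exists_pullbackForm_eq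
    (isBasicForm_sub_formOfConnections hp hpG hP.contMDiff_smul hsM hΞ hΘ))

omit [LieGroup 𝓘(ℝ, EG) ∞ G] [IsManifold 𝓘(ℝ, EM) ∞ M] [MulAction G M] in
-- U(1) preserves the fibres of p, and it preserves the fundamental fields of G because the two
-- actions commute.
theorem pullbackForm_circle_formOfConnections {p : P → M}
    (hp : IsPrincipalBundle (EP := EP) (EB := EM) (EK := EuclideanSpace ℝ (Fin 1)) Circle p)
    (hs : SmoothAction EG G EP P)
    {Ξ : OneForm EP P ℂ} (hΞ : IsCircleConnection Ξ) (Θ : OneForm EM M EG) (u : Circle) :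
    pullbackForm (fun z : P => u • z) (formOfConnections G p Ξ Θ) =
      formOfConnections G p Ξ Θ := by
  funext y
  refine ContinuousLinearMap.ext fun v => ?_
  have hsu : MDifferentiable 𝓘(ℝ, EP) 𝓘(ℝ, EP) (fun z : P => u • z) :=
    (SmoothAction.contMDiff_smul_left hp.contMDiff_smul u).mdifferentiable (by simp)
  have h2 : pullbackForm (fun z : P => u • z) (pullbackForm (E := EP) p Θ) y v =
      pullbackForm p Θ y v := by
    rw [← pullbackForm_comp_apply (hp.contMDiff_proj.mdifferentiableAt (by simp)) (hsu y)]
    have : (p ∘ fun z : P => u • z) = p := funext fun z => hp.proj_smul u z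
    rw [this]
  have h4 : pullbackForm (fun z : P => u • z) (formOfConnections G p Ξ Θ) y v =
    Ξ (u • y) (fundamentalVector EG G (u • y)
      (pullbackForm (fun z : P => u • z) (pullbackForm (E := EP) p Θ) y v)) := rfl
  rw [h4, h2, ← mfderiv_fundamentalVector hsu (fun g z => (smul_comm g u z).symm) hs]
  exact congrArg (fun β : OneForm EP P ℂ =>
    β y (fundamentalVector EG G y (pullbackForm p Θ y v))) (hΞ.invariant u)

/-- Points and tangent vectors of P/G lift to P, so each axiom is checked there for Ξ - Ξ(Θ). -/
theorem isCircleConnection_quotientConnection {p : P → M}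
    (hp : IsPrincipalBundle (EP := EP) (EB := EM) (EK := EuclideanSpace ℝ (Fin 1)) Circle p)
    (hpG : ∀ (g : G) (y : P), p (g • y) = g • p y)
    (hsM : SmoothAction EG G EM M)
    (hP : IsPrincipalBundle (EP := EP) (EB := EPG) (EK := EG) G
      (quotientMap G : P → Orbits G P))
    {Ξ : OneForm EP P ℂ} (hΞ : IsCircleConnection Ξ) (hΞG : IsInvariantForm G Ξ)
    {Θ : OneForm EM M EG} (hΘ : IsConnection G Θ) :
    IsCircleConnection (quotientConnection G p Ξ Θ EPG) := by
  have hpd : MDifferentiable 𝓘(ℝ, EP) 𝓘(ℝ, EM) p := hp.contMDiff_proj.mdifferentiable (by simp)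
  have hq : MDifferentiable 𝓘(ℝ, EP) 𝓘(ℝ, EPG) (quotientMap G : P → Orbits G P) :=
    hP.contMDiff_proj.mdifferentiable (by simp)
  have hpull := pullbackForm_quotientConnection (EPG := EPG) hpd hpG hsM hP hΞG hΘ
  have happ : ∀ (y : P) (v : TangentSpace 𝓘(ℝ, EP) y),
      quotientConnection G p Ξ Θ EPG (quotientMap G y)
        (mfderiv 𝓘(ℝ, EP) 𝓘(ℝ, EPG) (quotientMap G) y v) =
      Ξ y v - formOfConnections G p Ξ Θ y v := fun y v =>
    congrArg (fun β : OneForm EP P ℂ => β y v) hpull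
  have hsPG := smoothAction_orbits hp.contMDiff_smul hP
  refine ⟨?_, ?_, ?_, ?_⟩
  · refine hP.isSmoothForm_of_pullbackForm ?_
    rw [hpull]
    exact ContMDiff.sub hΞ.smooth (isSmoothForm_formOfConnections hp.contMDiff_proj
      hP.contMDiff_smul hΞ.smooth hΘ.smooth)
  · intro z w
    obtain ⟨y, rfl⟩ := quotientMap_surjective z
    obtain ⟨v, rfl⟩ := hP.mfderiv_surjective y w
    rw [happ, Complex.sub_re, hΞ.imaginary,
      show formOfConnections G p Ξ Θ y v = Ξ y _ from rfl, hΞ.imaginary, sub_zero]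
  · intro z
    obtain ⟨y, rfl⟩ := quotientMap_surjective z
    have h1 : (circleVector (quotientMap G y) : TangentSpace 𝓘(ℝ, EPG) (quotientMap G y)) =
        mfderiv 𝓘(ℝ, EP) 𝓘(ℝ, EPG) (quotientMap G) y (circleVector y) :=
      (mfderiv_circleVector hp.contMDiff_smul hq y).symm
    -- U(1)-orbits lie in fibres of p, so Ξ(Θ) vanishes on the generating field and Ξ alone
    -- contributes i.
    have h2 : mfderiv 𝓘(ℝ, EP) 𝓘(ℝ, EM) p y (circleVector y) = (0 : EM) := by
      rw [mfderiv_circleVector hp.contMDiff_smul hpd y]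
      have : (fun t : ℝ => p (Circle.exp t • y)) = fun _ => p y :=
        funext fun t => hp.proj_smul _ y
      have h3 : ∀ f : ℝ → M, f = (fun _ => p y) → (velocity EM f 0 : EM) = 0 := by
        rintro f rfl
        rw [velocity, mfderiv_const]
        rfl
      exact h3 _ this
    have h3 : formOfConnections G p Ξ Θ y (circleVector y) = 0 := by
      let L : EM →L[ℝ] EG := Θ (p y)
      let L' : EG →L[ℝ] ℂ := (Ξ y).comp (fundamentalVector EG G y)
      have h4 : L' (L (mfderiv 𝓘(ℝ, EP) 𝓘(ℝ, EM) p y (circleVector y))) = 0 :=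
        (congrArg (fun w : EM => L' (L w)) h2).trans (by simp)
      exact h4
    rw [h1, happ, h3, sub_zero, hΞ.vertical]
  · intro u
    funext z
    refine ContinuousLinearMap.ext fun w => ?_
    obtain ⟨y, rfl⟩ := quotientMap_surjective z
    obtain ⟨v, rfl⟩ := hP.mfderiv_surjective y w
    have hsu : MDifferentiableAt 𝓘(ℝ, EP) 𝓘(ℝ, EP) (fun z : P => u • z) y :=
      (SmoothAction.contMDiff_smul_left hp.contMDiff_smul u).mdifferentiableAt (by simp)
    have hsu' : MDifferentiableAt 𝓘(ℝ, EPG) 𝓘(ℝ, EPG) (fun z : Orbits G P => u • z)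
        (quotientMap G y) := (hsPG.contMDiff_smul_left u).mdifferentiableAt (by simp)
    have h1 : pullbackForm ((fun z : Orbits G P => u • z) ∘ quotientMap G)
        (quotientConnection G p Ξ Θ EPG) y v =
        pullbackForm (quotientMap G ∘ fun z : P => u • z)
        (quotientConnection G p Ξ Θ EPG) y v := rfl
    rw [pullbackForm_comp_apply hsu' (hq y), pullbackForm_comp_apply (hq _) hsu, hpull] at h1
    have h2 : pullbackForm (fun z : P => u • z) (Ξ - formOfConnections G p Ξ Θ) y v =
        pullbackForm (fun z : P => u • z) Ξ y v -
          pullbackForm (fun z : P => u • z) (formOfConnections G p Ξ Θ) y v := rfl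
    rw [h2, hΞ.invariant, pullbackForm_circle_formOfConnections hp hP.contMDiff_smul hΞ] at h1
    exact h1.trans (happ y v).symm

end QuotientConnection

/-! ### Curves with vanishing derivative off a finite set -/

section ZeroDerivative

variable {E : Type*} [NormedAddCommGroup E] [NormedSpace ℝ E]
  {N : Type*} [TopologicalSpace N] [ChartedSpace E N]

theorem eq_of_hasDerivAt_zero_off_finset {F : ℝ → E} {a b : ℝ} (S : Finset ℝ)
    (hc : ContinuousOn F (uIcc a b))
    (hd : ∀ t ∈ Ioo (min a b) (max a b), t ∉ S → HasDerivAt F 0 t) : F b = F a := by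
  rw [← sub_eq_zero]
  -- Testing against continuous functionals reduces to real functions, so completeness of `E` is not
  -- needed for the integral.
  refine SeparatingDual.eq_zero_of_forall_dual_eq_zero (R := ℝ) fun ℓ => ?_
  have h := MeasureTheory.integral_eq_of_hasDerivAt_off_countable (fun t => ℓ (F t))
    (fun _ => (0 : ℝ)) S.countable_toSet (ℓ.continuous.comp_continuousOn hc)
    (fun t ht => by
      have : HasDerivAt (fun t => ℓ (F t)) (ℓ 0) t :=
        ℓ.hasFDerivAt.comp_hasDerivAt t (hd t ht.1 (by simpa using ht.2))
      rwa [map_zero] at this) (by simp)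
  rw [map_sub, ← h]
  simp

/-- In the chart at `f t₀` the curve has zero derivative off `S`. The neighbourhood is taken within
the unit interval, so the end points are included. -/
theorem eventually_eq_of_mfderiv_eq_zero [IsManifold 𝓘(ℝ, E) 1 N] {f : ℝ → N} {t₀ : ℝ}
    {W : Set ℝ} (hW : W ∈ nhds t₀) (ht₀ : t₀ ∈ Icc (0 : ℝ) 1) (S : Finset ℝ)
    (hc : ContinuousOn f (W ∩ Icc 0 1))
    (hd : ∀ t ∈ W, t ∈ Ioo (0 : ℝ) 1 → t ∉ S →
      MDifferentiableAt 𝓘(ℝ, ℝ) 𝓘(ℝ, E) f t ∧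
        mfderiv 𝓘(ℝ, ℝ) 𝓘(ℝ, E) f t (1 : ℝ) = (0 : E)) :
    ∀ᶠ t in nhdsWithin t₀ (Icc 0 1), f t = f t₀ := by
  have h1 : f ⁻¹' (extChartAt 𝓘(ℝ, E) (f t₀)).source ∈ nhdsWithin t₀ (W ∩ Icc 0 1) :=
    hc t₀ ⟨mem_of_mem_nhds hW, ht₀⟩ (extChartAt_source_mem_nhds (I := 𝓘(ℝ, E)) (f t₀))
  rw [inter_comm, nhdsWithin_inter_of_mem' (mem_nhdsWithin_of_mem_nhds hW)] at h1
  obtain ⟨ε, hε, hball⟩ := Metric.mem_nhds_iff.1 (Filter.inter_mem hW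
    (mem_nhdsWithin_iff_exists_mem_nhds_inter.1 h1).choose_spec.1)
  have hsrc : ∀ t ∈ Metric.ball t₀ ε, t ∈ Icc (0 : ℝ) 1 →
      f t ∈ (extChartAt 𝓘(ℝ, E) (f t₀)).source := fun t ht htI =>
    (mem_nhdsWithin_iff_exists_mem_nhds_inter.1 h1).choose_spec.2 ⟨(hball ht).2, htI⟩
  filter_upwards [mem_nhdsWithin_of_mem_nhds (Metric.ball_mem_nhds t₀ hε),
    self_mem_nhdsWithin] with t ht htI
  have hball0 : t₀ ∈ Metric.ball t₀ ε := Metric.mem_ball_self hε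
  have hsub : uIcc t₀ t ⊆ Metric.ball t₀ ε ∩ Icc 0 1 := fun s hs =>
    ⟨((convex_ball t₀ ε).ordConnected.uIcc_subset hball0 ht) hs,
      ordConnected_Icc.uIcc_subset ht₀ htI hs⟩
  refine (extChartAt 𝓘(ℝ, E) (f t₀)).injOn (hsrc t ht htI) (hsrc t₀ hball0 ht₀) ?_
  refine eq_of_hasDerivAt_zero_off_finset (F := fun s => extChartAt 𝓘(ℝ, E) (f t₀) (f s)) S ?_ ?_
  · exact (continuousOn_extChartAt (f t₀)).comp
      (hc.mono fun s hs => ⟨(hball (hsub hs).1).1, (hsub hs).2⟩)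
      fun s hs => hsrc s (hsub hs).1 (hsub hs).2
  · intro s hs hsS
    have hsm := hsub (Ioo_subset_Icc_self hs)
    have hsI : s ∈ Ioo (0 : ℝ) 1 :=
      ⟨(le_min ht₀.1 htI.1).trans_lt hs.1, hs.2.trans_le (max_le ht₀.2 htI.2)⟩
    obtain ⟨h2, h3⟩ := hd s (hball hsm.1).1 hsI hsS
    have h4 : MDifferentiableAt 𝓘(ℝ, E) 𝓘(ℝ, E) (extChartAt 𝓘(ℝ, E) (f t₀)) (f s) :=
      mdifferentiableAt_extChartAt (by
        have := hsrc s hsm.1 hsm.2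
        rwa [extChartAt_source] at this)
    let L : E →L[ℝ] E := mfderiv 𝓘(ℝ, E) 𝓘(ℝ, E) (extChartAt 𝓘(ℝ, E) (f t₀)) (f s)
    have h7 : L (mfderiv 𝓘(ℝ, ℝ) 𝓘(ℝ, E) f s (1 : ℝ)) = 0 := (congrArg L h3).trans (map_zero L)
    let L' : ℝ →L[ℝ] E := mfderiv 𝓘(ℝ, ℝ) 𝓘(ℝ, E) f s
    have h5 : HasFDerivAt (fun s => extChartAt 𝓘(ℝ, E) (f t₀) (f s)) (L.comp L') s :=
      (h4.hasMFDerivAt.comp s h2.hasMFDerivAt).hasFDerivAt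
    have h6 : HasDerivAt (fun s => extChartAt 𝓘(ℝ, E) (f t₀) (f s)) (L (L' 1)) s :=
      h5.hasDerivAt
    rwa [show L (L' 1) = 0 from h7] at h6

end ZeroDerivative

/-! ### Piecewise C¹ curves and horizontality -/

section PiecewiseC1

variable {E : Type*} [NormedAddCommGroup E] [NormedSpace ℝ E]
  {M : Type*} [TopologicalSpace M] [ChartedSpace E M]
  {E' : Type*} [NormedAddCommGroup E'] [NormedSpace ℝ E']
  {M' : Type*} [TopologicalSpace M'] [ChartedSpace E' M']
  {V : Type*} [NormedAddCommGroup V] [NormedSpace ℝ V]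

theorem exists_Icc_avoiding (S : Finset ℝ) {t : ℝ} {U : Set ℝ} (hU : U ∈ nhds t) :
    ∃ ε > 0, Icc (t - ε) (t + ε) ⊆ U ∧ ∀ s ∈ S, s ∈ Icc (t - ε) (t + ε) → s = t := by
  have h1 : ((S.erase t : Finset ℝ) : Set ℝ)ᶜ ∈ nhds t :=
    (S.erase t).finite_toSet.isClosed.isOpen_compl.mem_nhds (by simp)
  obtain ⟨ε, hε, h2⟩ := (Metric.nhds_basis_closedBall.mem_iff).1 (Filter.inter_mem hU h1)
  rw [Real.closedBall_eq_Icc] at h2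
  refine ⟨ε, hε, fun s hs => (h2 hs).1, fun s hsS hs => ?_⟩
  by_contra hst
  exact (h2 hs).2 (by simp [hst, hsS])

/-- The velocities of a piecewise `C¹` curve exist outside a finite set. -/
theorem IsPiecewiseC1.exists_contMDiffAt {c : ℝ → M} (hc : IsPiecewiseC1 (E := E) c) :
    ∃ S : Finset ℝ, ∀ t ∈ Ioo (0 : ℝ) 1, t ∉ S → ContMDiffAt 𝓘(ℝ, ℝ) 𝓘(ℝ, E) 1 c t := by
  obtain ⟨-, S, hS⟩ := hc
  refine ⟨S, fun t ht htS => ?_⟩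
  obtain ⟨ε, hε, h1, h2⟩ := exists_Icc_avoiding S (Ioo_mem_nhds ht.1 ht.2)
  have ha := h1 (left_mem_Icc.2 (by linarith))
  have hb := h1 (right_mem_Icc.2 (by linarith))
  exact (hS (t - ε) (t + ε) ha.1.le (by linarith) hb.2.le fun s hs hst =>
    htS (h2 s hs (Ioo_subset_Icc_self hst) ▸ hs)).contMDiffAt
    (Icc_mem_nhds (by linarith) (by linarith))

theorem IsPiecewiseC1.comp {c : ℝ → M} (hc : IsPiecewiseC1 (E := E) c) {f : M → M'}
    (hf : ContMDiff 𝓘(ℝ, E) 𝓘(ℝ, E') 1 f) : IsPiecewiseC1 (E := E') (f ∘ c) := by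
  obtain ⟨h0, S, hS⟩ := hc
  exact ⟨hf.continuous.comp_continuousOn h0, S, fun a b ha hab hb h =>
    hf.comp_contMDiffOn (hS a b ha hab hb h)⟩

/-- A piecewise `C¹` curve whose velocities are annihilated by a smooth form outside a finite set
has all its velocities annihilated by the form. -/
theorem IsPiecewiseC1.pullbackForm_eq_zero [IsManifold 𝓘(ℝ, E) ∞ M] {c : ℝ → M}
    (hc : IsPiecewiseC1 (E := E) c) {α : OneForm E M V} (hα : IsSmoothForm α) {T : Finset ℝ}
    (hT : ∀ t ∈ Ioo (0 : ℝ) 1, t ∉ T → pullbackForm c α t (1 : ℝ) = 0) {t : ℝ}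
    (ht : t ∈ Ioo (0 : ℝ) 1) (hd : MDifferentiableAt 𝓘(ℝ, ℝ) 𝓘(ℝ, E) c t) :
    pullbackForm c α t (1 : ℝ) = 0 := by
  obtain ⟨-, S, hS⟩ := hc
  obtain ⟨ε, hε, h1, h2⟩ := exists_Icc_avoiding (S ∪ T) (Ioo_mem_nhds ht.1 ht.2)
  have hb := h1 (right_mem_Icc.2 (by linarith))
  have htε : t < t + ε := by linarith
  have hav : ∀ s ∈ S ∪ T, s ∉ Ioo t (t + ε) := fun s hs hst =>
    hst.1.ne' (h2 s hs ⟨by linarith [hst.1], hst.2.le⟩)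
  have hC : ContMDiffOn 𝓘(ℝ, ℝ) 𝓘(ℝ, E) 1 c (Icc t (t + ε)) :=
    hS t (t + ε) ht.1.le htε hb.2.le fun s hs => hav s (Finset.mem_union_left T hs)
  have hu : UniqueMDiffOn 𝓘(ℝ, ℝ) (Icc t (t + ε)) := (uniqueDiffOn_Icc htε).uniqueMDiffOn
  -- `g` evaluates α on the one-sided velocity. It is continuous up to `t` and zero to the right of
  -- `t`, hence zero at `t`, where it agrees with the value on the true velocity because `c` is
  -- differentiable there.
  let g : ℝ → V := fun s => formMap α
    (tangentMapWithin 𝓘(ℝ, ℝ) 𝓘(ℝ, E) c (Icc t (t + ε)) ⟨s, (1 : ℝ)⟩)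
  have hlift : Continuous (fun s : ℝ => (⟨s, (1 : ℝ)⟩ : TangentBundle 𝓘(ℝ, ℝ) ℝ)) := by
    rw [← (tangentBundleModelSpaceHomeomorph 𝓘(ℝ, ℝ)).comp_continuous_iff]
    exact continuous_id.prodMk continuous_const
  have hg : ContinuousOn g (Icc t (t + ε)) :=
    (ContMDiff.continuous hα).comp_continuousOn
      ((hC.continuousOn_tangentMapWithin le_rfl hu).comp hlift.continuousOn fun s hs => hs)
  have hg' : ∀ s ∈ Icc t (t + ε), MDifferentiableAt 𝓘(ℝ, ℝ) 𝓘(ℝ, E) c s →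
      g s = pullbackForm c α s (1 : ℝ) := fun s hs hds =>
    congrArg (formMap α) (tangentMapWithin_eq_tangentMap (hu s hs) hds)
  have h0 : EqOn g 0 (Ioo t (t + ε)) := fun s hs => by
    have hsd : MDifferentiableAt 𝓘(ℝ, ℝ) 𝓘(ℝ, E) c s :=
      (hC.contMDiffAt (Icc_mem_nhds hs.1 hs.2)).mdifferentiableAt one_ne_zero
    rw [hg' s (Ioo_subset_Icc_self hs) hsd]
    exact hT s ⟨ht.1.trans hs.1, hs.2.trans hb.2⟩ fun hsT =>
      hav s (Finset.mem_union_right S hsT) hs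
  have h3 := h0.of_subset_closure hg continuousOn_const Ioo_subset_Icc_self
    (by rw [closure_Ioo htε.ne])
  rw [← hg' t (left_mem_Icc.2 htε.le) hd]
  exact h3 (left_mem_Icc.2 htε.le)

theorem IsHorizontalLift.pullbackForm_eq_zero {B : Type*} {p : M → B} {α : OneForm E M V}
    {γ : ℝ → B} {c : ℝ → M} (h : IsHorizontalLift p α γ c) {t : ℝ} (ht : t ∈ Ioo (0 : ℝ) 1)
    (hd : MDifferentiableAt 𝓘(ℝ, ℝ) 𝓘(ℝ, E) c t) : pullbackForm c α t (1 : ℝ) = 0 :=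
  h.horizontal t ht hd

/-- Horizontality is required wherever the curve is differentiable, possibly at break points too;
continuity allows finitely many times to be ignored. -/
theorem isHorizontalLift_of_finset [IsManifold 𝓘(ℝ, E) ∞ M] {B : Type*} {p : M → B}
    {α : OneForm E M V} (hα : IsSmoothForm α) {γ : ℝ → B} {c : ℝ → M}
    (hc : IsPiecewiseC1 (E := E) c) (hp : ∀ t ∈ Icc (0 : ℝ) 1, p (c t) = γ t) (T : Finset ℝ)
    (hT : ∀ t ∈ Ioo (0 : ℝ) 1, t ∉ T → pullbackForm c α t (1 : ℝ) = 0) :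
    IsHorizontalLift p α γ c :=
  ⟨hc, hp, fun _ ht hd => hc.pullbackForm_eq_zero hα hT ht hd⟩

end PiecewiseC1

/-! ### Uniqueness of horizontal lifts up to a constant -/

section Uniqueness

variable {EK : Type*} [NormedAddCommGroup EK] [NormedSpace ℝ EK]
  {K : Type*} [TopologicalSpace K] [ChartedSpace EK K] [Group K] [LieGroup 𝓘(ℝ, EK) ∞ K]
  {EP : Type*} [NormedAddCommGroup EP] [NormedSpace ℝ EP]
  {P : Type*} [TopologicalSpace P] [ChartedSpace EP P] [MulAction K P]
  {EB : Type*} [NormedAddCommGroup EB] [NormedSpace ℝ EB]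
  {B : Type*} [TopologicalSpace B] [ChartedSpace EB B]
  {V : Type*} [NormedAddCommGroup V] [NormedSpace ℝ V]

/-- Two horizontal lifts of the same curve differ by a constant group element. -/
theorem IsHorizontalLift.exists_smul_eq {p : P → B}
    (h : IsPrincipalBundle (EK := EK) (EP := EP) (EB := EB) K p) {α : OneForm EP P V}
    (hα : SeparatesFibers (EG := EK) K α) {γ : ℝ → B} {c d : ℝ → P}
    (hc : IsHorizontalLift p α γ c) (hd : IsHorizontalLift p α γ d) :
    ∃ k : K, d 0 = k • c 0 ∧ d 1 = k • c 1 := by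
  have : IsManifold 𝓘(ℝ, EK) ∞ K := (inferInstance : ContMDiffMul 𝓘(ℝ, EK) ∞ K).toIsManifold
  obtain ⟨S, hS⟩ := hc.piecewise.exists_contMDiffAt
  obtain ⟨T, hT⟩ := hd.piecewise.exists_contMDiffAt
  -- The relation "one group element carries `c` to `d` at both times" holds locally and is
  -- transitive, so it spreads over the connected interval.
  refine isPreconnected_Icc.induction₂' (fun s t => ∃ k : K, d s = k • c s ∧ d t = k • c t)
    (fun t₀ ht₀ => ?_) ?_ (left_mem_Icc.2 zero_le_one) (right_mem_Icc.2 (zero_le_one (α := ℝ)))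
  · obtain ⟨U, κ, s, hU, htr⟩ := h.exists_isLocalTrivialization (p (c t₀))
    have hpc : ContinuousOn (p ∘ c) (Icc 0 1) :=
      h.contMDiff_proj.continuous.comp_continuousOn hc.piecewise.1
    obtain ⟨W, hWo, hWeq⟩ := (continuousOn_iff'.1 hpc) U htr.isOpen
    have hWc : ∀ t ∈ W ∩ Icc 0 1, p (c t) ∈ U := fun t ht => by
      rw [← hWeq] at ht
      exact ht.1
    have hpd : ∀ t ∈ Icc (0 : ℝ) 1, p (d t) = p (c t) := fun t ht => by
      rw [hc.proj_eq t ht, hd.proj_eq t ht]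
    have hWd : ∀ t ∈ W ∩ Icc 0 1, p (d t) ∈ U := fun t ht => by
      rw [hpd t ht.2]
      exact hWc t ht
    have ht₀W : t₀ ∈ W := by
      have : t₀ ∈ (p ∘ c) ⁻¹' U ∩ Icc 0 1 := ⟨hU, ht₀⟩
      rw [hWeq] at this
      exact this.1
    -- In a local trivialization the element carrying `c t` to `d t` is a quotient of fibre
    -- coordinates.
    let f : ℝ → K := fun t => κ (d t) * (κ (c t))⁻¹
    have hf : ∀ t ∈ W ∩ Icc 0 1, d t = f t • c t := fun t ht => by
      have h1 := htr.coord_smul_section (c t) (hWc t ht)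
      have h2 := htr.coord_smul_section (d t) (hWd t ht)
      rw [hpd t ht.2] at h2
      simp only [f]
      rw [mul_smul, inv_smul_eq_iff.2 h1.symm, h2]
    have hopen : IsOpen (p ⁻¹' U) := htr.isOpen.preimage h.contMDiff_proj.continuous
    have hdiv : ContMDiff (𝓘(ℝ, EK).prod 𝓘(ℝ, EK)) 𝓘(ℝ, EK) ∞
        (fun z : K × K => z.1 * z.2⁻¹) :=
      contMDiff_fst.mul contMDiff_snd.inv
    have := topologicalGroup_of_lieGroup 𝓘(ℝ, EK) ∞ (G := K)
    have hfc : ContinuousOn f (W ∩ Icc 0 1) :=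
      (htr.contMDiffOn_coord.continuousOn.comp (hd.piecewise.1.mono inter_subset_right) hWd).mul
        (htr.contMDiffOn_coord.continuousOn.comp (hc.piecewise.1.mono inter_subset_right)
          hWc).inv
    have hev := eventually_eq_of_mfderiv_eq_zero (f := f) (hWo.mem_nhds ht₀W) ht₀ (S ∪ T) hfc
      (fun t ht htI htST => by
        have htW : W ∩ Ioo 0 1 ∈ nhds t := (hWo.inter isOpen_Ioo).mem_nhds ⟨ht, htI⟩
        have htI' := Ioo_subset_Icc_self htI
        have hct := hS t htI fun h => htST (Finset.mem_union_left _ h)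
        have hdt := hT t htI fun h => htST (Finset.mem_union_right _ h)
        have hκ : ∀ y ∈ p ⁻¹' U, ContMDiffAt 𝓘(ℝ, EP) 𝓘(ℝ, EK) 1 κ y := fun y hy =>
          (htr.contMDiffOn_coord.contMDiffAt (hopen.mem_nhds hy)).of_le (by simp)
        have hft : ContMDiffAt 𝓘(ℝ, ℝ) 𝓘(ℝ, EK) 1 f t :=
          ContMDiffAt.comp (g := fun z : K × K => z.1 * z.2⁻¹)
            (f := fun t => (κ (d t), κ (c t))) t (hdiv.contMDiffAt.of_le (by simp))
            (((hκ _ (hWd t ⟨ht, htI'⟩)).comp t hdt).prodMk ((hκ _ (hWc t ⟨ht, htI'⟩)).comp t hct))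
        have hft' := hft.mdifferentiableAt one_ne_zero
        have hct' := hct.mdifferentiableAt one_ne_zero
        have hdt' := hdt.mdifferentiableAt one_ne_zero
        refine ⟨hft', hα.mfderiv_eq_zero h.contMDiff_smul hft' hct'
          (hc.pullbackForm_eq_zero htI hct') ?_⟩
        have heq : (fun z => f z • c z) =ᶠ[nhds t] d :=
          Filter.mem_of_superset htW fun z hz => (hf z ⟨hz.1, Ioo_subset_Icc_self hz.2⟩).symm
        exact (pullbackForm_congr heq (1 : ℝ)).trans (hd.pullbackForm_eq_zero htI hdt'))
    filter_upwards [hev, self_mem_nhdsWithin,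
      mem_nhdsWithin_of_mem_nhds (hWo.mem_nhds ht₀W)] with t ht htI htW
    exact ⟨⟨f t₀, hf t₀ ⟨ht₀W, ht₀⟩, ht ▸ hf t ⟨htW, htI⟩⟩,
      ⟨f t₀, ht ▸ hf t ⟨htW, htI⟩, hf t₀ ⟨ht₀W, ht₀⟩⟩⟩
  · rintro r s t - - - ⟨k, h1, h2⟩ ⟨l, h3, h4⟩
    -- Transitivity rests on the freeness of the action.
    have : k = l := h.smul_right_injective (c s) (h2.symm.trans h3)
    exact ⟨k, h1, this ▸ h4⟩

end Uniqueness

/-! ### Rotating a curve by a varying phase -/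

section CircleRotation

variable {EP : Type*} [NormedAddCommGroup EP] [NormedSpace ℝ EP]
  {P : Type*} [TopologicalSpace P] [ChartedSpace EP P] [MulAction Circle P]

theorem rightTranslation_circleExp {θ : ℝ → ℝ} {θ' t : ℝ} (h : HasDerivAt θ θ' t) :
    rightTranslation (EG := EuclideanSpace ℝ (Fin 1)) (Circle.exp (θ t))
      (mfderiv 𝓘(ℝ, ℝ) 𝓘(ℝ, EuclideanSpace ℝ (Fin 1)) (fun s => Circle.exp (θ s)) t (1 : ℝ)) =
      θ' • circleGenerator := by
  have hexp : ∀ x : ℝ, MDifferentiableAt 𝓘(ℝ, ℝ) 𝓘(ℝ, EuclideanSpace ℝ (Fin 1)) Circle.exp x :=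
    fun x => (contMDiff_circleExp (m := 1)).mdifferentiableAt one_ne_zero
  have hθ : MDifferentiableAt 𝓘(ℝ, ℝ) 𝓘(ℝ, ℝ) θ t := h.differentiableAt.mdifferentiableAt
  have h1 := mfderiv_comp_apply (I := 𝓘(ℝ, ℝ)) (I' := 𝓘(ℝ, EuclideanSpace ℝ (Fin 1)))
    (I'' := 𝓘(ℝ, EuclideanSpace ℝ (Fin 1))) (f := fun s => Circle.exp (θ s))
    (g := fun k : Circle => k * (Circle.exp (θ t))⁻¹) t
    ((contMDiff_mul_const _).mdifferentiableAt (by simp)) ((hexp _).comp t hθ) (1 : ℝ)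
  have h2 : ((fun k : Circle => k * (Circle.exp (θ t))⁻¹) ∘ fun s => Circle.exp (θ s)) =
      Circle.exp ∘ fun s => θ s - θ t := by
    funext s
    simp [Circle.exp_sub, div_eq_mul_inv]
  have hd : HasDerivAt (fun s => θ s - θ t) θ' t := h.sub_const _
  have h3 := mfderiv_comp_apply_of_eq (I := 𝓘(ℝ, ℝ)) (I' := 𝓘(ℝ, ℝ))
    (I'' := 𝓘(ℝ, EuclideanSpace ℝ (Fin 1))) (f := fun s => θ s - θ t) (g := Circle.exp)
    (x := t) (y := 0) (hexp 0) hd.differentiableAt.mdifferentiableAt (sub_self _) (1 : ℝ)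
  rw [h2] at h1
  have h4 : fderiv ℝ (fun s => θ s - θ t) t (1 : ℝ) = θ' := by
    rw [fderiv_apply_one_eq_deriv, hd.deriv]
  rw [← mfderiv_eq_fderiv] at h4
  let L : ℝ →L[ℝ] EuclideanSpace ℝ (Fin 1) :=
    mfderiv 𝓘(ℝ, ℝ) 𝓘(ℝ, EuclideanSpace ℝ (Fin 1)) Circle.exp 0
  have h5 : L θ' = θ' • L 1 := by
    rw [← map_smul, smul_eq_mul, mul_one]
  exact h1.symm.trans (h3.trans ((congrArg L h4).trans h5))

/-- This turns horizontality of a rotated lift into a prescribed derivative for the phase θ. -/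
theorem IsCircleConnection.pullbackForm_circleExp_smul [IsManifold 𝓘(ℝ, EP) ∞ P]
    {Ξ : OneForm EP P ℂ} (hΞ : IsCircleConnection Ξ)
    (hs : SmoothAction (EuclideanSpace ℝ (Fin 1)) Circle EP P) {θ : ℝ → ℝ} {θ' t : ℝ}
    (hθ : HasDerivAt θ θ' t) {c : ℝ → P} (hc : MDifferentiableAt 𝓘(ℝ, ℝ) 𝓘(ℝ, EP) c t) :
    pullbackForm (fun s => Circle.exp (θ s) • c s) Ξ t (1 : ℝ) =
      θ' * Complex.I + pullbackForm c Ξ t (1 : ℝ) := by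
  have hexp : MDifferentiableAt 𝓘(ℝ, ℝ) 𝓘(ℝ, EuclideanSpace ℝ (Fin 1))
      (fun s => Circle.exp (θ s)) t :=
    ((contMDiff_circleExp (m := 1)).mdifferentiableAt one_ne_zero).comp t
      hθ.differentiableAt.mdifferentiableAt
  refine (pullbackForm_smul_apply hs Ξ hexp hc (1 : ℝ)).trans ?_
  rw [hΞ.invariant, rightTranslation_circleExp hθ]
  have h1 := hΞ.vertical (Circle.exp (θ t) • c t)
  rw [circleVector_eq hs, map_neg] at h1
  let L : EuclideanSpace ℝ (Fin 1) →L[ℝ] ℂ := (Ξ (Circle.exp (θ t) • c t)).comp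
    (fundamentalVector (EuclideanSpace ℝ (Fin 1)) Circle (Circle.exp (θ t) • c t))
  have h2 : -L (θ' • circleGenerator) = θ' * Complex.I := by
    rw [map_smul, ← smul_neg, show -L circleGenerator = Complex.I from h1, Complex.real_smul]
  exact congrArg (fun z : ℂ => z + pullbackForm c Ξ t (1 : ℝ)) h2

end CircleRotation

/-! ### Existence of horizontal lifts in U(1)-bundles -/

section Existence

variable {EP : Type*} [NormedAddCommGroup EP] [NormedSpace ℝ EP]
  {P : Type*} [TopologicalSpace P] [ChartedSpace EP P]
  {B : Type*}
  {V : Type*} [NormedAddCommGroup V] [NormedSpace ℝ V]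

/-- `c` is a lift of `γ` on `[a, b]` which is `C¹` with horizontal velocities away from the break
points in a finite set. -/
structure IsHorizontalLiftOn (p : P → B) (α : OneForm EP P V) (γ : ℝ → B) (c : ℝ → P)
    (a b : ℝ) : Prop where
  continuousOn : ContinuousOn c (Icc a b)
  proj_eq : ∀ t ∈ Icc a b, p (c t) = γ t
  exists_finset : ∃ S : Finset ℝ,
    (∀ a' b' : ℝ, a ≤ a' → a' < b' → b' ≤ b → (∀ s ∈ S, s ∉ Ioo a' b') →
      ContMDiffOn 𝓘(ℝ, ℝ) 𝓘(ℝ, EP) 1 c (Icc a' b')) ∧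
    ∀ t ∈ Ioo a b, t ∉ S → pullbackForm c α t (1 : ℝ) = 0

theorem IsHorizontalLiftOn.isHorizontalLift [IsManifold 𝓘(ℝ, EP) ∞ P] {p : P → B}
    {α : OneForm EP P V} (hα : IsSmoothForm α) {γ : ℝ → B} {c : ℝ → P}
    (h : IsHorizontalLiftOn p α γ c 0 1) : IsHorizontalLift p α γ c := by
  obtain ⟨S, hS, hS'⟩ := h.exists_finset
  exact isHorizontalLift_of_finset hα ⟨h.continuousOn, S, hS⟩ h.proj_eq S hS'

/-- Every point over `γ(a)` is the initial point of a horizontal lift on `[a, b]`. -/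
def HasHorizontalLiftsOn (p : P → B) (α : OneForm EP P V) (γ : ℝ → B) (a b : ℝ) : Prop :=
  ∀ y, p y = γ a → ∃ c, IsHorizontalLiftOn p α γ c a b ∧ c a = y

theorem HasHorizontalLiftsOn.refl (p : P → B) (α : OneForm EP P V) (γ : ℝ → B) (a : ℝ) :
    HasHorizontalLiftsOn p α γ a a := fun y hy => by
  refine ⟨fun _ => y, ⟨continuousOn_const, fun t ht => ?_, ∅, fun a' b' h1 h2 h3 => ?_,
    fun t ht => ?_⟩, rfl⟩
  · rw [hy, le_antisymm ht.2 ht.1]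
  · linarith
  · exact absurd (ht.1.trans ht.2) (lt_irrefl _)

theorem HasHorizontalLiftsOn.trans {p : P → B} {α : OneForm EP P V} {γ : ℝ → B} {a b d : ℝ}
    (hab : a ≤ b) (hbd : b ≤ d) (h₁ : HasHorizontalLiftsOn p α γ a b)
    (h₂ : HasHorizontalLiftsOn p α γ b d) : HasHorizontalLiftsOn p α γ a d := by
  intro y hy
  obtain ⟨c₁, hc₁, hy₁⟩ := h₁ y hy
  obtain ⟨c₂, hc₂, hy₂⟩ := h₂ (c₁ b) (hc₁.proj_eq b (right_mem_Icc.2 hab))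
  let c : ℝ → P := fun t => if t ≤ b then c₁ t else c₂ t
  have e₁ : ∀ t, t ≤ b → c t = c₁ t := fun t ht => if_pos ht
  have e₂ : ∀ t, b ≤ t → c t = c₂ t := fun t ht => by
    rcases ht.eq_or_lt with rfl | h
    · rw [e₁ _ le_rfl, hy₂]
    · exact if_neg h.not_ge
  obtain ⟨S, hS, hS'⟩ := hc₁.exists_finset
  obtain ⟨T, hT, hT'⟩ := hc₂.exists_finset
  -- The junction `b` becomes a break point, since the two pieces need not fit together in C¹
  -- fashion.
  refine ⟨c, ⟨?_, ?_, S ∪ T ∪ {b}, ?_, ?_⟩, (e₁ a hab).trans hy₁⟩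
  · rw [← Icc_union_Icc_eq_Icc hab hbd]
    exact (hc₁.continuousOn.congr fun t ht => e₁ t ht.2).union_of_isClosed
      (hc₂.continuousOn.congr fun t ht => e₂ t ht.1) isClosed_Icc isClosed_Icc
  · intro t ht
    rcases le_total t b with h | h
    · rw [e₁ t h, hc₁.proj_eq t ⟨ht.1, h⟩]
    · rw [e₂ t h, hc₂.proj_eq t ⟨h, ht.2⟩]
  · intro a' b' h1 h2 h3 h4
    rcases le_or_gt b' b with h | h
    · exact (hS a' b' h1 h2 h fun s hs => h4 s (by simp [hs])).congr
        fun t ht => e₁ t (ht.2.trans h)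
    · have h5 : b ≤ a' := by
        by_contra h6
        exact h4 b (by simp) ⟨not_le.1 h6, h⟩
      exact (hT a' b' h5 h2 h3 fun s hs => h4 s (by simp [hs])).congr
        fun t ht => e₂ t (h5.trans ht.1)
  · intro t ht htS
    simp only [Finset.mem_union, Finset.mem_singleton, not_or] at htS
    rcases lt_or_gt_of_ne htS.2 with h | h
    · have : c =ᶠ[nhds t] c₁ := Filter.mem_of_superset (Iio_mem_nhds h)
        fun s hs => e₁ s (le_of_lt hs)
      exact (pullbackForm_congr this (1 : ℝ)).trans (hS' t ⟨ht.1, h⟩ htS.1.1)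
    · have : c =ᶠ[nhds t] c₂ := Filter.mem_of_superset (Ioi_mem_nhds h)
        fun s hs => e₂ s (le_of_lt hs)
      exact (pullbackForm_congr this (1 : ℝ)).trans (hT' t ⟨h, ht.2⟩ htS.1.2)

/-- By compactness the unit interval has a finite subdivision with each piece inside some `W`; the
lifts are concatenated. -/
theorem HasHorizontalLiftsOn.of_locally {p : P → B} {α : OneForm EP P V} {γ : ℝ → B}
    (h : ∀ t₀ ∈ Icc (0 : ℝ) 1, ∃ W : Set ℝ, IsOpen W ∧ t₀ ∈ W ∧ ∀ a b : ℝ, a ∈ Icc (0 : ℝ) 1 →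
      b ∈ Icc (0 : ℝ) 1 → a ≤ b → Icc a b ⊆ W → HasHorizontalLiftsOn p α γ a b) :
    HasHorizontalLiftsOn p α γ 0 1 := by
  choose W hWo hWt hW using h
  obtain ⟨t, ht0, htm, ⟨m, hm⟩, hcov⟩ := exists_monotone_Icc_subset_open_cover_Icc
    (zero_le_one (α := ℝ)) (c := fun x : Icc (0 : ℝ) 1 => Subtype.val ⁻¹' W x.1 x.2)
    (fun x => (hWo x.1 x.2).preimage continuous_subtype_val)
    (fun x _ => mem_iUnion.2 ⟨x, hWt x.1 x.2⟩)
  have key : ∀ n, HasHorizontalLiftsOn p α γ 0 (t n) := by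
    intro n
    induction n with
    | zero =>
      rw [ht0]
      exact .refl p α γ 0
    | succ n ih =>
      refine ih.trans (t n).2.1 (htm n.le_succ) ?_
      obtain ⟨x, hx⟩ := hcov n
      exact hW x.1 x.2 _ _ (t n).2 (t (n + 1)).2 (htm n.le_succ) fun s hs =>
        hx (show (⟨s, (t n).2.1.trans hs.1, hs.2.trans (t (n + 1)).2.2⟩ : Icc (0 : ℝ) 1) ∈
          Icc (t n) (t (n + 1)) from ⟨hs.1, hs.2⟩)
  have := key m
  rwa [hm m le_rfl] at this

variable {EB : Type*} [NormedAddCommGroup EB] [NormedSpace ℝ EB]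
  [TopologicalSpace B] [ChartedSpace EB B] [MulAction Circle P] [IsManifold 𝓘(ℝ, EP) ∞ P]

/-- Any C¹ lift `c₀` becomes horizontal after rotation by exp(iθ), where θ is minus the integral of
the imaginary part of Ξ on the velocity of `c₀`. -/
theorem IsCircleConnection.hasHorizontalLiftsOn_of_contMDiffOn {p : P → B}
    (hp : IsPrincipalBundle (EP := EP) (EB := EB) (EK := EuclideanSpace ℝ (Fin 1)) Circle p)
    {Ξ : OneForm EP P ℂ} (hΞ : IsCircleConnection Ξ) {U : Set B} {κ : P → Circle} {s : B → P}
    (htr : IsLocalTrivialization (EuclideanSpace ℝ (Fin 1)) EP EB p U κ s) {γ : ℝ → B} {a b : ℝ}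
    (hab : a < b) (hγ : ContMDiffOn 𝓘(ℝ, ℝ) 𝓘(ℝ, EB) 1 γ (Icc a b))
    (hU : ∀ t ∈ Icc a b, γ t ∈ U) : HasHorizontalLiftsOn p Ξ γ a b := by
  intro y hy
  let c₀ : ℝ → P := fun t => κ y • s (γ t)
  have hc₀ : ContMDiffOn 𝓘(ℝ, ℝ) 𝓘(ℝ, EP) 1 c₀ (Icc a b) :=
    ((SmoothAction.contMDiff_smul_left hp.contMDiff_smul (κ y)).of_le
      (by simp)).comp_contMDiffOn
        ((htr.contMDiffOn_section.of_le (by simp)).comp hγ hU)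
  have hc₀a : c₀ a = y := by
    simp only [c₀]
    rw [← hy]
    exact htr.coord_smul_section y (hy ▸ hU a (left_mem_Icc.2 hab.le))
  have hu : UniqueMDiffOn 𝓘(ℝ, ℝ) (Icc a b) := (uniqueDiffOn_Icc hab).uniqueMDiffOn
  let f : ℝ → ℝ := fun t => (formMap Ξ
    (tangentMapWithin 𝓘(ℝ, ℝ) 𝓘(ℝ, EP) c₀ (Icc a b) ⟨t, (1 : ℝ)⟩)).im
  have hlift : Continuous (fun t : ℝ => (⟨t, (1 : ℝ)⟩ : TangentBundle 𝓘(ℝ, ℝ) ℝ)) := by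
    rw [← (tangentBundleModelSpaceHomeomorph 𝓘(ℝ, ℝ)).comp_continuous_iff]
    exact continuous_id.prodMk continuous_const
  have hf : ContinuousOn f (Icc a b) :=
    Complex.continuous_im.comp_continuousOn ((ContMDiff.continuous hΞ.smooth).comp_continuousOn
      ((hc₀.continuousOn_tangentMapWithin le_rfl hu).comp hlift.continuousOn fun s hs => hs))
  -- The constant extension beyond the end points makes θ a C¹ function on all of ℝ.
  let F : ℝ → ℝ := IccExtend hab.le ((Icc a b).domRestrict f)
  have hF : Continuous F := hf.domRestrict.Icc_extend'
  let θ : ℝ → ℝ := fun t => -∫ x in a..t, F x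
  have hθ : ∀ t, HasDerivAt θ (-F t) t := fun t =>
    (intervalIntegral.integral_hasDerivAt_right (hF.intervalIntegrable _ _)
      (hF.stronglyMeasurableAtFilter _ _) hF.continuousAt).neg
  have hθC : ContDiff ℝ 1 θ := by
    refine contDiff_one_iff_deriv.2 ⟨fun t => (hθ t).differentiableAt, ?_⟩
    rw [show deriv θ = fun t => -F t from funext fun t => (hθ t).deriv]
    exact hF.neg
  let c : ℝ → P := fun t => Circle.exp (θ t) • c₀ t
  have hc : ContMDiffOn 𝓘(ℝ, ℝ) 𝓘(ℝ, EP) 1 c (Icc a b) :=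
    ContMDiff.comp_contMDiffOn (g := fun z : Circle × P => z.1 • z.2)
      (f := fun t => (Circle.exp (θ t), c₀ t)) (hp.contMDiff_smul.of_le (by simp))
      ((contMDiff_circleExp.comp hθC.contMDiff).contMDiffOn.prodMk hc₀)
  refine ⟨c, ⟨hc.continuousOn, fun t ht => ?_, ∅, fun a' b' h1 _ h2 _ =>
    hc.mono (Icc_subset_Icc h1 h2), fun t ht _ => ?_⟩, ?_⟩
  · simp only [c, c₀]
    rw [hp.proj_smul, hp.proj_smul, htr.proj_section _ (hU t ht)]
  · have htI := Ioo_subset_Icc_self ht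
    have hd : MDifferentiableAt 𝓘(ℝ, ℝ) 𝓘(ℝ, EP) c₀ t :=
      (hc₀.contMDiffAt (Icc_mem_nhds ht.1 ht.2)).mdifferentiableAt one_ne_zero
    refine (hΞ.pullbackForm_circleExp_smul hp.contMDiff_smul (hθ t) hd).trans ?_
    have h1 : F t = (pullbackForm c₀ Ξ t (1 : ℝ)).im := by
      have h2 : F t = f t := IccExtend_of_mem hab.le _ htI
      rw [h2]
      exact congrArg (fun v => (formMap Ξ v).im) (tangentMapWithin_eq_tangentMap (hu t htI) hd)
    have h3 : (pullbackForm c₀ Ξ t (1 : ℝ)).re = 0 := hΞ.imaginary _ _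
    apply Complex.ext
    · simp [h3]
    · simp [h1]
  · simp [c, θ, hc₀a]

theorem IsCircleConnection.hasHorizontalLiftsOn {p : P → B}
    (hp : IsPrincipalBundle (EP := EP) (EB := EB) (EK := EuclideanSpace ℝ (Fin 1)) Circle p)
    {Ξ : OneForm EP P ℂ} (hΞ : IsCircleConnection Ξ) {γ : ℝ → B}
    (hγ : IsPiecewiseC1 (E := EB) γ) : HasHorizontalLiftsOn p Ξ γ 0 1 := by
  obtain ⟨hγc, S, hS⟩ := hγ
  refine .of_locally fun t₀ ht₀ => ?_
  obtain ⟨U, κ, s, hU, htr⟩ := hp.exists_isLocalTrivialization (γ t₀)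
  obtain ⟨W, hWo, hWeq⟩ := (continuousOn_iff'.1 hγc) U htr.isOpen
  have hW : ∀ t ∈ W, t ∈ Icc 0 1 → γ t ∈ U := fun t ht htI => by
    have : t ∈ W ∩ Icc 0 1 := ⟨ht, htI⟩
    rw [← hWeq] at this
    exact this.1
  have ht₀W : t₀ ∈ W := by
    have : t₀ ∈ γ ⁻¹' U ∩ Icc 0 1 := ⟨hU, ht₀⟩
    rw [hWeq] at this
    exact this.1
  have hdirect : ∀ a b : ℝ, a ∈ Icc (0 : ℝ) 1 → b ∈ Icc (0 : ℝ) 1 → a ≤ b → Icc a b ⊆ W →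
      (∀ s ∈ S, s ∉ Ioo a b) → HasHorizontalLiftsOn p Ξ γ a b := by
    intro a b ha hb hab habW h
    rcases hab.eq_or_lt with rfl | hab
    · exact .refl p Ξ γ a
    · exact hΞ.hasHorizontalLiftsOn_of_contMDiffOn hp htr hab (hS a b ha.1 hab hb.2 h)
        fun t ht => hW t (habW ht) ⟨ha.1.trans ht.1, ht.2.trans hb.2⟩
  have hSo : IsOpen ((S.erase t₀ : Finset ℝ) : Set ℝ)ᶜ :=
    (S.erase t₀).finite_toSet.isClosed.isOpen_compl
  -- All break points except `t₀` are removed, so a subinterval needs to be cut at most once, at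
  -- `t₀`.
  refine ⟨W ∩ ((S.erase t₀ : Finset ℝ) : Set ℝ)ᶜ, hWo.inter hSo, ⟨ht₀W, by simp⟩, ?_⟩
  intro a b ha hb hab habW
  have hS' : ∀ s ∈ S, s ∈ Icc a b → s = t₀ := fun s hs hst => by
    by_contra hne
    exact (habW hst).2 (by simp [hne, hs])
  have habW' : Icc a b ⊆ W := fun s hs => (habW hs).1
  by_cases h : t₀ ∈ Ioo a b
  · refine (hdirect a t₀ ha ht₀ h.1.le ((Icc_subset_Icc_right h.2.le).trans habW')
      fun s hs hst => ?_).trans h.1.le h.2.le (hdirect t₀ b ht₀ hb h.2.le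
        ((Icc_subset_Icc_left h.1.le).trans habW') fun s hs hst => ?_)
    · exact hst.2.ne (hS' s hs ⟨hst.1.le, hst.2.le.trans h.2.le⟩)
    · exact hst.1.ne' (hS' s hs ⟨h.1.le.trans hst.1.le, hst.2.le⟩)
  · exact hdirect a b ha hb hab habW' fun s hs hst =>
      h (hS' s hs (Ioo_subset_Icc_self hst) ▸ hst)

theorem IsCircleConnection.exists_isHorizontalLift {p : P → B}
    (hp : IsPrincipalBundle (EP := EP) (EB := EB) (EK := EuclideanSpace ℝ (Fin 1)) Circle p)
    {Ξ : OneForm EP P ℂ} (hΞ : IsCircleConnection Ξ) {γ : ℝ → B}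
    (hγ : IsPiecewiseC1 (E := EB) γ) {y : P} (hy : p y = γ 0) :
    ∃ c, IsHorizontalLift p Ξ γ c ∧ c 0 = y := by
  obtain ⟨c, hc, hcy⟩ := hΞ.hasHorizontalLiftsOn hp hγ y hy
  exact ⟨c, hc.isHorizontalLift hΞ.smooth, hcy⟩

end Existence

/-! ### Existence of the holonomies -/

section Holonomy

variable {EK : Type*} [NormedAddCommGroup EK] [NormedSpace ℝ EK]
  {K : Type*} [TopologicalSpace K] [ChartedSpace EK K] [Group K] [LieGroup 𝓘(ℝ, EK) ∞ K]
  {EP : Type*} [NormedAddCommGroup EP] [NormedSpace ℝ EP]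
  {P : Type*} [TopologicalSpace P] [ChartedSpace EP P] [MulAction K P]
  {EB : Type*} [NormedAddCommGroup EB] [NormedSpace ℝ EB]
  {B : Type*} [TopologicalSpace B] [ChartedSpace EB B]
  {V : Type*} [NormedAddCommGroup V] [NormedSpace ℝ V]

theorem IsHorizontalLift.eq_of_zero_eq {p : P → B}
    (h : IsPrincipalBundle (EK := EK) (EP := EP) (EB := EB) K p) {α : OneForm EP P V}
    (hα : SeparatesFibers (EG := EK) K α) {γ : ℝ → B} {c d : ℝ → P}
    (hc : IsHorizontalLift p α γ c) (hd : IsHorizontalLift p α γ d) (h0 : d 0 = c 0) :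
    d 1 = c 1 := by
  obtain ⟨k, h1, h2⟩ := hc.exists_smul_eq h hα hd
  have hk : k = 1 := h.smul_right_injective (c 0) (by simp [← h1, h0])
  rw [h2, hk, one_smul]

theorem IsHorizontalLift.isHolonomyAt_holonomyAt {p : P → B}
    (h : IsPrincipalBundle (EK := EK) (EP := EP) (EB := EB) K p) {α : OneForm EP P V}
    (hα : SeparatesFibers (EG := EK) K α) {γ : ℝ → B} {c : ℝ → P}
    (hc : IsHorizontalLift p α γ c) (hγ : γ 1 = γ 0) :
    IsHolonomyAt p α (c 0) γ (holonomyAt K p α (c 0) γ) := by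
  have hex : ∃ k : K, IsHolonomyAt p α (c 0) γ k := by
    obtain ⟨k, hk⟩ := h.exists_smul_eq (y := c 0) (z := c 1) (by
      rw [hc.proj_eq 0 (left_mem_Icc.2 zero_le_one), hc.proj_eq 1 (right_mem_Icc.2 zero_le_one),
        hγ])
    exact ⟨k, ⟨c, hc, rfl⟩, fun d hd h0 => (hc.eq_of_zero_eq h hα hd h0).trans hk⟩
  rw [holonomyAt, dif_pos hex]
  exact hex.choose_spec

end Holonomy

/-! ### Equivariant holonomy -/

section EquivariantHolonomy

variable {G : Type*} [Group G]
  {EM : Type*} [NormedAddCommGroup EM] [NormedSpace ℝ EM]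
  {M : Type*} [TopologicalSpace M] [ChartedSpace EM M] [MulAction G M]
  {EP : Type*} [NormedAddCommGroup EP] [NormedSpace ℝ EP]
  {P : Type*} [TopologicalSpace P] [ChartedSpace EP P] [IsManifold 𝓘(ℝ, EP) ∞ P]
  [MulAction G P] [MulAction Circle P] [SMulCommClass G Circle P]

theorem isEquivariantHolonomy_equivariantHolonomy {p : P → M}
    (hp : IsPrincipalBundle (EP := EP) (EB := EM) (EK := EuclideanSpace ℝ (Fin 1)) Circle p)
    (hpG : ∀ (g : G) (y : P), p (g • y) = g • p y)
    {Ξ : OneForm EP P ℂ} (hΞ : IsCircleConnection Ξ) {φ : G} {γ : ℝ → M}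
    (hγ : γ ∈ twistedLoops EM M φ) :
    IsEquivariantHolonomy p Ξ φ γ (equivariantHolonomy p Ξ φ γ) := by
  have hex : ∃ u : Circle, IsEquivariantHolonomy p Ξ φ γ u := by
    obtain ⟨y₀, hy₀⟩ := hp.surjective (γ 0)
    obtain ⟨c, hc, hc0⟩ := hΞ.exists_isHorizontalLift hp hγ.1 hy₀
    obtain ⟨u, hu⟩ := hp.exists_smul_eq (y := φ • y₀) (z := c 1) (by
      rw [hpG, hy₀, hc.proj_eq 1 (right_mem_Icc.2 zero_le_one), hγ.2])
    refine ⟨u, fun y hy => ⟨hΞ.exists_isHorizontalLift hp hγ.1 hy, fun d hd hd0 => ?_⟩⟩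
    -- A lift starting elsewhere in the fibre is a constant rotation of `c`. Since `k` commutes with
    -- φ and with `u`, the same `u` serves every starting point.
    obtain ⟨k, h1, h2⟩ := hc.exists_smul_eq hp (hΞ.separatesFibers hp.contMDiff_smul) hd
    rw [h2, hu, ← hd0, h1, hc0, smul_comm φ k y₀, smul_comm k u]
  rw [equivariantHolonomy, dif_pos hex]
  exact hex.choose_spec

end EquivariantHolonomy

/-! ### Comparison of the two holonomies -/

section QuotientHolonomy

variable {EG : Type*} [NormedAddCommGroup EG] [NormedSpace ℝ EG]
  {G : Type*} [TopologicalSpace G] [ChartedSpace EG G] [Group G] [LieGroup 𝓘(ℝ, EG) ∞ G]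
  {EM : Type*} [NormedAddCommGroup EM] [NormedSpace ℝ EM]
  {M : Type*} [TopologicalSpace M] [ChartedSpace EM M] [IsManifold 𝓘(ℝ, EM) ∞ M]
  [MulAction G M]
  {EP : Type*} [NormedAddCommGroup EP] [NormedSpace ℝ EP]
  {P : Type*} [TopologicalSpace P] [ChartedSpace EP P] [IsManifold 𝓘(ℝ, EP) ∞ P]
  [MulAction G P] [MulAction Circle P] [SMulCommClass G Circle P]
  {EMG : Type*} [NormedAddCommGroup EMG] [NormedSpace ℝ EMG] [ChartedSpace EMG (Orbits G M)]
  {EPG : Type*} [NormedAddCommGroup EPG] [NormedSpace ℝ EPG]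
  [ChartedSpace EPG (Orbits G P)] [IsManifold 𝓘(ℝ, EPG) ∞ (Orbits G P)]

/-- The projection to `P/G` of a `Ξ`-horizontal lift of a `Θ`-horizontal curve is horizontal for
the quotient connection. -/
theorem IsHorizontalLift.quotientMap_comp {p : P → M}
    (hp : IsPrincipalBundle (EP := EP) (EB := EM) (EK := EuclideanSpace ℝ (Fin 1)) Circle p)
    (hpG : ∀ (g : G) (y : P), p (g • y) = g • p y)
    (hsM : SmoothAction EG G EM M)
    (hP : IsPrincipalBundle (EP := EP) (EB := EPG) (EK := EG) G
      (quotientMap G : P → Orbits G P))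
    {Ξ : OneForm EP P ℂ} (hΞ : IsCircleConnection Ξ) (hΞG : IsInvariantForm G Ξ)
    {Θ : OneForm EM M EG} (hΘ : IsConnection G Θ) {γ : ℝ → Orbits G M} {γhat : ℝ → M}
    (hγhat : IsHorizontalLift (quotientMap G) Θ γ γhat) {c : ℝ → P}
    (hc : IsHorizontalLift p Ξ γhat c) :
    IsHorizontalLift (quotientProj G p hpG) (quotientConnection G p Ξ Θ EPG) γ
      (quotientMap G ∘ c) := by
  have hpd : MDifferentiable 𝓘(ℝ, EP) 𝓘(ℝ, EM) p := hp.contMDiff_proj.mdifferentiable (by simp)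
  have hq : MDifferentiable 𝓘(ℝ, EP) 𝓘(ℝ, EPG) (quotientMap G : P → Orbits G P) :=
    hP.contMDiff_proj.mdifferentiable (by simp)
  obtain ⟨S, hS⟩ := hc.piecewise.exists_contMDiffAt
  refine isHorizontalLift_of_finset
    (isCircleConnection_quotientConnection hp hpG hsM hP hΞ hΞG hΘ).smooth
    (hc.piecewise.comp (hP.contMDiff_proj.of_le (by simp))) (fun t ht => ?_) S
    fun t ht htS => ?_
  · rw [Function.comp_apply, quotientProj_quotientMap, hc.proj_eq t ht, hγhat.proj_eq t ht]
  · have hct := (hS t ht htS).mdifferentiableAt one_ne_zero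
    -- Near an interior time `γhat` is p ∘ c, so it is differentiable where `c` is, and its velocity
    -- is the image of that of `c`.
    have heq : p ∘ c =ᶠ[nhds t] γhat := Filter.mem_of_superset (Icc_mem_nhds ht.1 ht.2) hc.proj_eq
    have hγt : MDifferentiableAt 𝓘(ℝ, ℝ) 𝓘(ℝ, EM) γhat t :=
      ((hpd _).comp t hct).congr_of_eventuallyEq heq.symm
    have h1 : pullbackForm c (pullbackForm (E := EP) p Θ) t (1 : ℝ) = 0 :=
      (pullbackForm_comp_apply (hpd _) hct (1 : ℝ)).symm.trans
        ((pullbackForm_congr heq (1 : ℝ)).trans (hγhat.pullbackForm_eq_zero ht hγt))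
    let L : EG →L[ℝ] ℂ := (Ξ (c t)).comp (fundamentalVector EG G (c t))
    have h2 : pullbackForm c (formOfConnections G p Ξ Θ) t (1 : ℝ) = 0 :=
      (congrArg L h1).trans (map_zero L)
    refine (pullbackForm_comp_apply (hq _) hct (1 : ℝ)).trans ?_
    rw [pullbackForm_quotientConnection hpd hpG hsM hP hΞG hΘ]
    exact (congrArg₂ (fun a b : ℂ => a - b) (hc.pullbackForm_eq_zero ht hct) h2).trans
      (sub_zero 0)

theorem isHolonomy_quotientConnection {p : P → M}
    (hp : IsPrincipalBundle (EP := EP) (EB := EM) (EK := EuclideanSpace ℝ (Fin 1)) Circle p)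
    (hpG : ∀ (g : G) (y : P), p (g • y) = g • p y)
    (hM : IsPrincipalBundle (EP := EM) (EB := EMG) (EK := EG) G
      (quotientMap G : M → Orbits G M))
    (hP : IsPrincipalBundle (EP := EP) (EB := EPG) (EK := EG) G
      (quotientMap G : P → Orbits G P))
    {Ξ : OneForm EP P ℂ} (hΞ : IsCircleConnection Ξ) (hΞG : IsInvariantForm G Ξ)
    {Θ : OneForm EM M EG} (hΘ : IsConnection G Θ) {γ : ℝ → Orbits G M} {γhat : ℝ → M}
    (hγhat : IsHorizontalLift (quotientMap G) Θ γ γhat) {φ : G} {u : Circle}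
    (hu : IsEquivariantHolonomy p Ξ φ γhat u) :
    IsHolonomy (quotientProj G p hpG) (quotientConnection G p Ξ Θ EPG) γ u := by
  intro z hz
  obtain ⟨y, rfl⟩ := quotientMap_surjective z
  rw [quotientProj_quotientMap, ← hγhat.proj_eq 0 (left_mem_Icc.2 zero_le_one)] at hz
  -- Any point of P/G over γ(0) has a representative in P over `γhat 0`, where the hypothesis on `u`
  -- applies.
  obtain ⟨g, hg⟩ := exists_smul_eq_of_quotientMap_eq hz
  have hy : p (g⁻¹ • y) = γhat 0 := by rw [hpG, ← hg, inv_smul_smul]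
  rw [← quotientMap_smul g⁻¹ y]
  obtain ⟨⟨c, hc, hc0⟩, hc1⟩ := hu _ hy
  have hqc := IsHorizontalLift.quotientMap_comp (EPG := EPG) hp hpG hM.contMDiff_smul hP hΞ hΞG hΘ
    hγhat hc
  refine ⟨⟨_, hqc, congrArg (quotientMap G) hc0⟩, fun d hd hd0 => ?_⟩
  have h1 := hqc.eq_of_zero_eq (isPrincipalBundle_quotientProj hp hpG hM hP)
    ((isCircleConnection_quotientConnection hp hpG hM.contMDiff_smul hP hΞ hΞG hΘ).separatesFibers
      (smoothAction_orbits hp.contMDiff_smul hP)) hd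
    (hd0.trans (congrArg (quotientMap G) hc0).symm)
  -- Here φ disappears: `φ • y` and `y` have the same image in P/G.
  rw [h1, Function.comp_apply, hc1 c hc hc0, ← quotientMap_circle_smul, quotientMap_smul]

end QuotientHolonomy

/-! ### Uniqueness of the U(1)-holonomy -/

section HolonomyUnique

variable {EP : Type*} [NormedAddCommGroup EP] [NormedSpace ℝ EP]
  {P : Type*} [TopologicalSpace P] [ChartedSpace EP P] [MulAction Circle P]
  {B : Type*}

theorem IsHolonomy.isHolonomy_holonomy {p : P → B} {Ξ : OneForm EP P ℂ} {γ : ℝ → B} {u : Circle}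
    (hu : IsHolonomy p Ξ γ u) : IsHolonomy p Ξ γ (holonomy p Ξ γ) := by
  have hex : ∃ u : Circle, IsHolonomy p Ξ γ u := ⟨u, hu⟩
  rw [holonomy, dif_pos hex]
  exact hex.choose_spec

theorem IsHolonomy.unique {EB : Type*} [NormedAddCommGroup EB] [NormedSpace ℝ EB]
    [TopologicalSpace B] [ChartedSpace EB B] {p : P → B}
    (hp : IsPrincipalBundle (EP := EP) (EB := EB) (EK := EuclideanSpace ℝ (Fin 1)) Circle p)
    {Ξ : OneForm EP P ℂ} {γ : ℝ → B} {u v : Circle} (hu : IsHolonomy p Ξ γ u)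
    (hv : IsHolonomy p Ξ γ v) : u = v := by
  obtain ⟨y, hy⟩ := hp.surjective (γ 0)
  obtain ⟨⟨c, hc, hc0⟩, hc1⟩ := hu y hy
  exact hp.smul_right_injective y ((hc1 c hc hc0).symm.trans ((hv y hy).2 c hc hc0))

end HolonomyUnique

end EquivHol

end

open EquivHol in
theorem mainTheorem7
    -- the Lie group `G`
    {EG : Type*} [NormedAddCommGroup EG] [NormedSpace ℝ EG]
    {G : Type*} [TopologicalSpace G] [ChartedSpace EG G] [Group G] [LieGroup 𝓘(ℝ, EG) ∞ G]
    -- the `G`-manifolds `M` and `P`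
    {EM : Type*} [NormedAddCommGroup EM] [NormedSpace ℝ EM]
    {M : Type*} [TopologicalSpace M] [ChartedSpace EM M] [IsManifold 𝓘(ℝ, EM) ∞ M]
    [MulAction G M]
    {EP : Type*} [NormedAddCommGroup EP] [NormedSpace ℝ EP]
    {P : Type*} [TopologicalSpace P] [ChartedSpace EP P] [IsManifold 𝓘(ℝ, EP) ∞ P]
    [MulAction G P] [MulAction Circle P] [SMulCommClass G Circle P]
    -- the manifolds `M/G` and `P/G`
    {EMG : Type*} [NormedAddCommGroup EMG] [NormedSpace ℝ EMG]
    [ChartedSpace EMG (Orbits G M)] [IsManifold 𝓘(ℝ, EMG) ∞ (Orbits G M)]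
    {EPG : Type*} [NormedAddCommGroup EPG] [NormedSpace ℝ EPG]
    [ChartedSpace EPG (Orbits G P)] [IsManifold 𝓘(ℝ, EPG) ∞ (Orbits G P)]
    -- `P → M` is a `G`-equivariant principal `U(1)`-bundle
    (p : P → M) (hp : IsPrincipalBundle (EP := EP) (EB := EM) (EK := EuclideanSpace ℝ (Fin 1))
      Circle p)
    (hpG : ∀ (g : G) (y : P), p (g • y) = g • p y)
    -- `M → M/G` and `P → P/G` are principal `G`-bundles
    (hM : IsPrincipalBundle (EP := EM) (EB := EMG) (EK := EG) G
      (quotientMap G : M → Orbits G M))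
    (hP : IsPrincipalBundle (EP := EP) (EB := EPG) (EK := EG) G
      (quotientMap G : P → Orbits G P))
    -- a `G`-invariant connection on `P → M` and a connection on `M → M/G`
    (Ξ : OneForm EP P ℂ) (hΞ : IsCircleConnection Ξ) (hΞG : IsInvariantForm G Ξ)
    (Θ : OneForm EM M EG) (hΘ : IsConnection G Θ)
    -- a loop on `M/G` and a `Θ`-horizontal lift
    (γ : ℝ → Orbits G M) (hγ : γ ∈ loops EMG (Orbits G M))
    (γhat : ℝ → M) (hγhat : IsHorizontalLift (quotientMap G) Θ γ γhat) :
    -- `P/G → M/G` is a principal `U(1)`-bundle, and `Ξ_Θ` is a connection on it and the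
    -- projection of `Ξ - Ξ(Θ)`
    (IsPrincipalBundle (EP := EPG) (EB := EMG) (EK := EuclideanSpace ℝ (Fin 1))
        Circle (quotientProj G p hpG) ∧
      IsCircleConnection (quotientConnection G p Ξ Θ EPG) ∧
      pullbackForm (quotientMap G) (quotientConnection G p Ξ Θ EPG) =
        Ξ - formOfConnections G p Ξ Θ) ∧
    -- the three holonomies are well defined
    (IsHolonomyAt (quotientMap G) Θ (γhat 0) γ (holonomyAt G (quotientMap G) Θ (γhat 0) γ) ∧
      IsHolonomy (quotientProj G p hpG) (quotientConnection G p Ξ Θ EPG) γ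
        (holonomy (quotientProj G p hpG) (quotientConnection G p Ξ Θ EPG) γ) ∧
      IsEquivariantHolonomy p Ξ (holonomyAt G (quotientMap G) Θ (γhat 0) γ) γhat
        (equivariantHolonomy p Ξ (holonomyAt G (quotientMap G) Θ (γhat 0) γ) γhat)) ∧
    γhat ∈ twistedLoops EM M (holonomyAt G (quotientMap G) Θ (γhat 0) γ) ∧
    holonomy (quotientProj G p hpG) (quotientConnection G p Ξ Θ EPG) γ =
      equivariantHolonomy p Ξ (holonomyAt G (quotientMap G) Θ (γhat 0) γ) γhat := by
  have hholM := hγhat.isHolonomyAt_holonomyAt hM hΘ.separatesFibers hγ.2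
  have htwist : γhat ∈ twistedLoops EM M (holonomyAt G (quotientMap G) Θ (γhat 0) γ) :=
    -- `γhat` is itself one of the lifts whose end point defines φ.
    ⟨hγhat.piecewise, hholM.2 γhat hγhat rfl⟩
  have hequiv := isEquivariantHolonomy_equivariantHolonomy hp hpG hΞ htwist
  have hhol := isHolonomy_quotientConnection (EPG := EPG) hp hpG hM hP hΞ hΞG hΘ hγhat hequiv
  have hPG := isPrincipalBundle_quotientProj hp hpG hM hP
  exact ⟨⟨hPG, isCircleConnection_quotientConnection hp hpG hM.contMDiff_smul hP hΞ hΞG hΘ,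
      pullbackForm_quotientConnection (hp.contMDiff_proj.mdifferentiable (by simp)) hpG
        hM.contMDiff_smul hP hΞG hΘ⟩,
    ⟨hholM, hhol.isHolonomy_holonomy, hequiv⟩, htwist, hhol.isHolonomy_holonomy.unique hPG hhol⟩
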